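/- All topological spaces are Hausdorff and all linear spaces are real. For a compact space $X$ and a locally convex space $E$, let $C_p(X,E)$ denote the linear space of all continuous functions $X\to E$ with the topology of pointwise convergence, and write $C_p(X)=C_p(X,\mathbb{R})$. Let $C(X)_w$ denote the Banach space $C(X)$ of continuous real-valued functions on $X$ (with the supremum norm), endowed with its weak topology. Let $(c_0)_p$ be the space of all real sequences convergent to $0$ with the pointwise topology inherited from $\mathbb{R}^{\omega}$. A space $X$ is scattered if every nonempty subset $A$ of $X$ has a point isolated in $A$. A locally convex space $E$ contains a complemented copy of $F$ if there are closed linear subspaces $E_1,E_2$ of $E$ such that $E=E_1\oplus E_2$ algebraically, the projection of $E$ onto $E_1$ along $E_2$ is continuous, and $E_1$ is linearly homeomorphic to $F$. Let $X$ be a non-scattered compact space such that $C_p(X)$ does not contain a complemented copy of $(c_0)_p$. Then there is no continuous linear surjection from $C_p(X,C_p(X))$ onto $C_p(X,C(X)_w)$. Moreover, the Čech–Stone compactification $\beta\omega$ of the discrete space $\omega$ is such a space: it is non-scattered and $C_p(\beta\omega)$ does not contain a complemented copy of $(c_0)_p$. Hence there is no continuous linear surjection from $C_p(\beta\omega,C_p(\beta\omega))$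 onto $C_p(\beta\omega,C(\beta\omega)_w)$. -/

import Mathlib

/-- A topological space is scattered if each of its nonempty subsets `A` has a point which is
isolated in `A`. -/
def IsScatteredSpace (X : Type*) [TopologicalSpace X] : Prop :=
  ∀ A : Set X, A.Nonempty → ∃ x ∈ A, ∃ U : Set X, IsOpen U ∧ U ∩ A = {x}

/-- `Cp X E` is the space of all continuous functions from `X` to `E`, as a linear subspace of
the product `X → E`; its topology is the pointwise one, inherited from the product. -/
abbrev Cp (X : Type*) [TopologicalSpace X] (E : Type*) [AddCommGroup E] [Module ℝ E]
    [TopologicalSpace E] [IsTopologicalAddGroup E] [ContinuousConstSMul ℝ E] :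
    Submodule ℝ (X → E) :=
  continuousSubmodule X ℝ E

/-- `(c₀)ₚ`: the real sequences convergent to `0`, with the pointwise topology inherited from
`ℕ → ℝ`. -/
def c0p : Submodule ℝ (ℕ → ℝ) where
  carrier := {x | Filter.Tendsto x Filter.atTop (nhds 0)}
  add_mem' {x y} hx hy := by
    have h : Filter.Tendsto (fun n => x n + y n) Filter.atTop (nhds (0 + 0)) :=
      Filter.Tendsto.add hx hy
    rw [add_zero] at h
    exact h
  zero_mem' := tendsto_const_nhds
  smul_mem' c {x} hx := by
    have h : Filter.Tendsto (fun n => c * x n) Filter.atTop (nhds (c * 0)) :=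
      Filter.Tendsto.const_mul c hx
    rw [mul_zero] at h
    exact h

/-- `E` contains a complemented copy of `F`: there are closed linear subspaces `E₁`, `E₂` of `E`
such that `E` is their algebraic direct sum, the projection of `E` onto `E₁` along `E₂` is
continuous (this and the previous condition are `Submodule.IsTopCompl`), and `E₁` is linearly
homeomorphic to `F`. -/
def ContainsComplementedCopy (E : Type*) [AddCommGroup E] [Module ℝ E] [TopologicalSpace E]
    (F : Type*) [AddCommGroup F] [Module ℝ F] [TopologicalSpace F] : Prop :=
  ∃ E₁ E₂ : Submodule ℝ E, IsClosed (E₁ : Set E) ∧ IsClosed (E₂ : Set E) ∧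
    Submodule.IsTopCompl E₁ E₂ ∧ Nonempty (E₁ ≃L[ℝ] F)

/-! A non-scattered compact X carries a weak-star null sequence of functionals μ_n on C(X) with
norms at least 1. If T were a continuous linear surjection, composing T with evaluation at a point
and with μ_n would give functionals on C_p(X, C_p(X)), that is, finitely supported measures m_n on X
× X that tend to 0 on every separately continuous function.

Such measures live on finitely many horizontal and vertical fibres (`exists_finite_fibres`);
otherwise a sum of products of bumps in disjoint boxes is separately continuous and has unbounded
integrals. On a fibre the measures are null against enough of C(X), and the absence of a
complemented (c₀)ₚ turns this into convergence in variation (`tendsto_fvar_of_tendsto_fpair`, a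
gliding hump argument). So the variations ε_n of m_n tend to 0, and |m_n(g)| ≤ C_g ε_n since g is
bounded on each fibre. Surjectivity, used only for constant functions, gives |μ_n(f)| ≤ C_f ε_n for
every f in C(X), so Banach–Steinhaus forces ‖μ_n‖ → 0, a contradiction.

The μ_n are limits of Rademacher averages along a Cantor scheme in a perfect subset of X; Bessel's
inequality makes them weak-star null.

For βω, a complemented (c₀)ₚ is excluded as in Whitley's proof that c₀ is not complemented in ℓ∞:
the embedding extends to bounded sequences, and on an uncountable almost disjoint family countably
many functionals must all vanish at some indicator, which would then be a null sequence. -/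

open Filter Topology Set

/-! ### Finitely supported signed measures -/

/-- The integral of `f` with respect to the finitely supported signed measure `μ`. -/
noncomputable def fpair {X : Type*} (μ : X →₀ ℝ) (f : X → ℝ) : ℝ :=
  ∑ x ∈ μ.support, μ x * f x

/-- The variation of the finitely supported signed measure `μ` on the set `s`. -/
noncomputable def fvar {X : Type*} (μ : X →₀ ℝ) (s : Set X) : ℝ :=
  ∑ x ∈ μ.support, s.indicator (fun x => |μ x|) x

section FinitelySupported

variable {X : Type*}

theorem fpair_eq_sum (μ : X →₀ ℝ) {F : Finset X} (h : μ.support ⊆ F) (f : X → ℝ) :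
    fpair μ f = ∑ x ∈ F, μ x * f x :=
  Finset.sum_subset h fun x _ hx => by simp [Finsupp.notMem_support_iff.1 hx]

theorem fvar_eq_sum (μ : X →₀ ℝ) {F : Finset X} (h : μ.support ⊆ F) (s : Set X) :
    fvar μ s = ∑ x ∈ F, s.indicator (fun x => |μ x|) x :=
  Finset.sum_subset h fun x _ hx => by
    simp [Finsupp.notMem_support_iff.1 hx]

theorem fpair_add_left (μ ν : X →₀ ℝ) (f : X → ℝ) :
    fpair (μ + ν) f = fpair μ f + fpair ν f := by
  classical
  rw [fpair_eq_sum (μ + ν) Finsupp.support_add, fpair_eq_sum μ Finset.subset_union_left,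
    fpair_eq_sum ν Finset.subset_union_right, ← Finset.sum_add_distrib]
  exact Finset.sum_congr rfl fun x _ => by simp [add_mul]

theorem fpair_smul_left (c : ℝ) (μ : X →₀ ℝ) (f : X → ℝ) :
    fpair (c • μ) f = c * fpair μ f := by
  rw [fpair_eq_sum (c • μ) Finsupp.support_smul, fpair, Finset.mul_sum]
  exact Finset.sum_congr rfl fun x _ => by simp [mul_assoc]

theorem fpair_sub_left (μ ν : X →₀ ℝ) (f : X → ℝ) :
    fpair (μ - ν) f = fpair μ f - fpair ν f := by
  have : μ - ν = μ + (-1 : ℝ) • ν := by simp [sub_eq_add_neg]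
  rw [this, fpair_add_left, fpair_smul_left]; ring

theorem fpair_sum_left {ι : Type*} (t : Finset ι) (μ : ι → X →₀ ℝ) (f : X → ℝ) :
    fpair (∑ i ∈ t, μ i) f = ∑ i ∈ t, fpair (μ i) f := by
  classical
  induction t using Finset.induction_on with
  | empty => simp [fpair]
  | insert a t ha ih => rw [Finset.sum_insert ha, Finset.sum_insert ha, fpair_add_left, ih]

theorem fpair_single (x : X) (c : ℝ) (f : X → ℝ) : fpair (Finsupp.single x c) f = c * f x := by
  rw [fpair_eq_sum _ Finsupp.support_single_subset]; simp

theorem fpair_add_right (μ : X →₀ ℝ) (f g : X → ℝ) :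
    fpair μ (f + g) = fpair μ f + fpair μ g := by
  simp [fpair, mul_add, Finset.sum_add_distrib]

theorem fpair_smul_right (μ : X →₀ ℝ) (c : ℝ) (f : X → ℝ) :
    fpair μ (c • f) = c * fpair μ f := by
  rw [fpair, fpair, Finset.mul_sum]
  exact Finset.sum_congr rfl fun x _ => by simp; ring

theorem fpair_congr (μ : X →₀ ℝ) {f g : X → ℝ} (h : ∀ x ∈ μ.support, f x = g x) :
    fpair μ f = fpair μ g :=
  Finset.sum_congr rfl fun x hx => by rw [h x hx]

theorem fpair_eq_zero (μ : X →₀ ℝ) {f : X → ℝ} (h : ∀ x ∈ μ.support, f x = 0) :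
    fpair μ f = 0 :=
  Finset.sum_eq_zero fun x hx => by rw [h x hx, mul_zero]

theorem fvar_nonneg (μ : X →₀ ℝ) (s : Set X) : 0 ≤ fvar μ s :=
  Finset.sum_nonneg fun _ _ => Set.indicator_nonneg (fun _ _ => abs_nonneg _) _

theorem fvar_univ (μ : X →₀ ℝ) : fvar μ univ = ∑ x ∈ μ.support, |μ x| := by
  simp [fvar]

theorem fvar_mono (μ : X →₀ ℝ) {s t : Set X} (h : ∀ x ∈ μ.support, x ∈ s → x ∈ t) :
    fvar μ s ≤ fvar μ t := by
  classical
  refine Finset.sum_le_sum fun x hx => ?_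
  simp only [Set.indicator_apply]
  split_ifs with h1 h2
  · rfl
  · exact absurd (h x hx h1) h2
  · exact abs_nonneg _
  · rfl

theorem fvar_union_le (μ : X →₀ ℝ) (s t : Set X) : fvar μ (s ∪ t) ≤ fvar μ s + fvar μ t := by
  classical
  rw [fvar, fvar, fvar, ← Finset.sum_add_distrib]
  refine Finset.sum_le_sum fun x _ => ?_
  simp only [Set.indicator_apply, Set.mem_union]
  have := abs_nonneg (μ x)
  by_cases h1 : x ∈ s <;> by_cases h2 : x ∈ t <;> simp [h1, h2]

theorem fvar_biUnion_le {ι : Type*} (μ : X →₀ ℝ) (J : Finset ι) (s : ι → Set X) :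
    fvar μ (⋃ i ∈ J, s i) ≤ ∑ i ∈ J, fvar μ (s i) := by
  classical
  induction J using Finset.induction_on with
  | empty => simp [fvar]
  | insert a t ha ih =>
    rw [Finset.set_biUnion_insert, Finset.sum_insert ha]
    exact (fvar_union_le _ _ _).trans (by gcongr)

theorem sum_fvar_le {ι : Type*} (μ : X →₀ ℝ) (J : Finset ι) (s : ι → Set X)
    (h : (J : Set ι).PairwiseDisjoint s) : ∑ i ∈ J, fvar μ (s i) ≤ fvar μ univ := by
  classical
  rw [fvar_univ]
  simp only [fvar]
  rw [Finset.sum_comm]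
  refine Finset.sum_le_sum fun x _ => ?_
  by_cases hx : ∃ i ∈ J, x ∈ s i
  · obtain ⟨i, hi, hxi⟩ := hx
    rw [Finset.sum_eq_single_of_mem i hi]
    · simp [hxi]
    · intro j hj hji
      have : x ∉ s j := fun hxj => (Set.disjoint_left.1 (h hj hi hji)) hxj hxi
      simp [this]
  · push Not at hx
    rw [Finset.sum_eq_zero fun i hi => by simp [hx i hi]]
    exact abs_nonneg _

theorem fvar_finset (μ : X →₀ ℝ) (F : Finset X) : fvar μ (F : Set X) = ∑ x ∈ F, |μ x| := by
  classical
  rw [fvar_eq_sum μ (F := μ.support ∪ F) Finset.subset_union_left]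
  simp only [Set.indicator_apply, Finset.mem_coe]
  rw [← Finset.sum_filter]
  congr 1
  ext x; simp

theorem fvar_smul (c : ℝ) (μ : X →₀ ℝ) (s : Set X) : fvar (c • μ) s = |c| * fvar μ s := by
  classical
  rw [fvar_eq_sum (c • μ) Finsupp.support_smul, fvar, Finset.mul_sum]
  refine Finset.sum_congr rfl fun x _ => ?_
  simp only [Set.indicator_apply]
  split_ifs <;> simp [abs_mul]

theorem fvar_sub_le (μ ν : X →₀ ℝ) (s : Set X) : fvar (μ - ν) s ≤ fvar μ s + fvar ν s := by
  classical
  have h : (μ - ν).support ⊆ μ.support ∪ ν.support := Finsupp.support_sub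
  rw [fvar_eq_sum _ h, fvar_eq_sum μ (Finset.subset_union_left (s₂ := ν.support)),
    fvar_eq_sum ν (Finset.subset_union_right (s₁ := μ.support)), ← Finset.sum_add_distrib]
  refine Finset.sum_le_sum fun x _ => ?_
  simp only [Set.indicator_apply]
  split_ifs
  · simpa using abs_sub (μ x) (ν x)
  · simp

theorem abs_fpair_le (μ : X →₀ ℝ) (f : X → ℝ) (s : Set X) (C : ℝ)
    (hf : ∀ x ∈ μ.support, |f x| ≤ C) (hs : ∀ x ∈ μ.support, x ∉ s → f x = 0) :
    |fpair μ f| ≤ C * fvar μ s := by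
  classical
  refine (Finset.abs_sum_le_sum_abs _ _).trans ?_
  rw [fvar, Finset.mul_sum]
  refine Finset.sum_le_sum fun x hx => ?_
  by_cases h : x ∈ s
  · rw [Set.indicator_of_mem h, abs_mul, mul_comm]
    exact mul_le_mul_of_nonneg_right (hf x hx) (abs_nonneg _)
  · simp [h, hs x hx h]

theorem tendsto_fvar_finset {ι : Type*} {l : Filter ι} {ν : ι → X →₀ ℝ}
    (h : ∀ x, Tendsto (fun n => ν n x) l (𝓝 0)) (F : Finset X) :
    Tendsto (fun n => fvar (ν n) F) l (𝓝 0) := by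
  simp only [fvar_finset]
  rw [show (0 : ℝ) = ∑ x ∈ F, |(0 : ℝ)| by simp]
  exact tendsto_finsetSum _ fun x _ => (h x).abs

end FinitelySupported

/-! ### Urysohn functions with prescribed values -/

section Urysohn

variable {X : Type*} [TopologicalSpace X] [CompactSpace X] [T2Space X]

/-- A bounded function prescribed on a finite part of an open set, and vanishing off that set. -/
theorem exists_continuous_prescribed (F : Finset X) {V : Set X} (hV : IsOpen V) (σ : X → ℝ)
    (hσ : ∀ x, |σ x| ≤ 1) :
    ∃ f : C(X, ℝ), (∀ x, |f x| ≤ 1) ∧ (∀ x ∈ F, x ∈ V → f x = σ x) ∧ ∀ x, x ∉ V → f x = 0 := by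
  classical
  have key : ∀ x : X, ∃ φ : C(X, ℝ), (x ∈ V → φ x = 1) ∧ (∀ y ∈ F, y ≠ x → φ y = 0) ∧
      ∀ y, y ∉ V → φ y = 0 := by
    intro x
    by_cases hx : x ∈ V
    · have hc : IsClosed (Vᶜ ∪ ((F.erase x : Finset X) : Set X)) :=
        hV.isClosed_compl.union (Finset.finite_toSet _).isClosed
      obtain ⟨φ, h0, h1, -⟩ := exists_continuous_zero_one_of_isClosed hc
        (isClosed_singleton (x := x)) (by
          rw [Set.disjoint_singleton_right]
          rintro (h | h)
          · exact h hx
          · simp at h)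
      refine ⟨φ, fun _ => h1 rfl, fun y hy hyx => h0 (Or.inr ?_), fun y hy => h0 (Or.inl hy)⟩
      simp [hy, hyx]
    · exact ⟨0, fun h => absurd h hx, fun _ _ _ => rfl, fun _ _ => rfl⟩
  choose φ h1 h2 h3 using key
  let g : C(X, ℝ) := ∑ x ∈ F, σ x • φ x
  have hg : ∀ y, g y = ∑ x ∈ F, σ x * φ x y := fun y => by simp [g]
  -- Truncation to [-1, 1] bounds the function without changing its values on `F ∩ V`, where it
  -- equals `σ`, or off `V`, where it is 0.
  refine ⟨⟨fun y => max (-1) (min 1 (g y)), by fun_prop⟩, fun x => ?_, fun x hx hxV => ?_,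
    fun x hx => ?_⟩
  · simp only [ContinuousMap.coe_mk]
    rw [abs_le]
    exact ⟨le_max_left _ _, max_le (by norm_num) (min_le_left _ _)⟩
  · have : g x = σ x := by
      rw [hg, Finset.sum_eq_single_of_mem x hx]
      · rw [h1 x hxV, mul_one]
      · intro y _ hyx
        rw [h2 y x hx hyx.symm, mul_zero]
    have hb := abs_le.1 (hσ x)
    simp [this, hb.1, hb.2]
  · have : g x = 0 := by
      rw [hg]
      exact Finset.sum_eq_zero fun y _ => by rw [h3 y x hx, mul_zero]
    simp [this]

theorem exists_continuous_bump (F : Finset X) {V : Set X} (hV : IsOpen V) {x : X} (hx : x ∈ V) :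
    ∃ f : C(X, ℝ), f x = 1 ∧ (∀ y, |f y| ≤ 1) ∧ (∀ y ∈ F, y ≠ x → f y = 0) ∧
      ∀ y, y ∉ V → f y = 0 := by
  classical
  obtain ⟨f, h1, h2, h3⟩ := exists_continuous_prescribed (insert x F) hV
    (fun y => if y = x then 1 else 0) (fun y => by split_ifs <;> simp)
  refine ⟨f, by simpa using h2 x (by simp) hx, h1, fun y hy hyx => ?_, h3⟩
  by_cases hyV : y ∈ V
  · rw [h2 y (by simp [hy]) hyV, if_neg hyx]
  · exact h3 y hyV

/-- A function in the unit ball that norms a finitely supported measure on an open set. -/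
theorem exists_continuous_norming (μ : X →₀ ℝ) {V : Set X} (hV : IsOpen V) :
    ∃ f : C(X, ℝ), (∀ x, |f x| ≤ 1) ∧ (∀ x, x ∉ V → f x = 0) ∧ fpair μ f = fvar μ V := by
  classical
  obtain ⟨f, h1, h2, h3⟩ := exists_continuous_prescribed μ.support hV
    (fun x => (SignType.sign (μ x) : ℝ)) (fun x => by
      rcases lt_trichotomy (μ x) 0 with h | h | h <;> simp [h])
  refine ⟨f, h1, h3, Finset.sum_congr rfl fun x hx => ?_⟩
  by_cases hxV : x ∈ V
  · rw [h2 x hx hxV, Set.indicator_of_mem hxV, self_mul_sign]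
  · rw [h3 x hxV, Set.indicator_of_notMem hxV, mul_zero]

end Urysohn

/-! ### Complemented copies from biorthogonal sequences -/

/-- `S ∘ P` is a continuous idempotent, so its range and kernel are topological complements, and `P`
restricted to the range inverts `S`. -/
theorem ContainsComplementedCopy.of_leftInverse {E F : Type*} [AddCommGroup E] [Module ℝ E]
    [TopologicalSpace E] [IsTopologicalAddGroup E] [T1Space E] [AddCommGroup F] [Module ℝ F]
    [TopologicalSpace F] (P : E →L[ℝ] F) (S : F →L[ℝ] E) (h : ∀ y, P (S y) = y) :
    ContainsComplementedCopy E F := by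
  have hid : IsIdempotentElem (S.comp P) := by
    ext x
    simp [h]
  have hc := ContinuousLinearMap.IsIdempotentElem.isTopCompl hid
  refine ⟨_, _, ?_, ?_, hc, ⟨?_⟩⟩
  · have : ((S.comp P).range : Set E) = {x | x - S (P x) ∈ ({0} : Set E)} := by
      ext x
      constructor
      · rintro ⟨y, rfl⟩
        simp [h]
      · intro hx
        exact ⟨x, by simpa using (sub_eq_zero.1 hx).symm⟩
    rw [this]
    exact isClosed_singleton.preimage (continuous_id.sub (S.continuous.comp P.continuous))
  · have : ((S.comp P).ker : Set E) = S.comp P ⁻¹' {0} := by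
      ext x; simp
    rw [this]
    exact isClosed_singleton.preimage (S.comp P).continuous
  · refine ContinuousLinearEquiv.equivOfInverse (P.comp (S.comp P).range.subtypeL)
      (S.codRestrict _ fun y => ⟨S y, by simp [h]⟩) ?_ ?_
    · rintro ⟨_, y, rfl⟩
      exact Subtype.ext (congrArg S (h (P y)))
    · exact h

/-- Solutions of a lower triangular system with small null columns inherit convergence to `0`. -/
theorem tendsto_zero_of_triangular {a b : ℕ → ℝ} {L : ℕ → ℕ → ℝ}
    (hab : ∀ k, a k = b k - ∑ j ∈ Finset.range k, L k j * a j)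
    (hL : ∀ k j, j < k → |L k j| ≤ (1 / 2) ^ (j + 2))
    (hL0 : ∀ j, Tendsto (fun k => L k j) atTop (𝓝 0))
    (hb : Tendsto b atTop (𝓝 0)) : Tendsto a atTop (𝓝 0) := by
  obtain ⟨B, hB⟩ : ∃ B, ∀ k, |b k| ≤ B := by
    obtain ⟨B, hB⟩ := (Metric.isBounded_range_of_tendsto b hb).exists_norm_le
    exact ⟨B, fun k => hB _ ⟨k, rfl⟩⟩
  have hB0 : 0 ≤ B := (abs_nonneg _).trans (hB 0)
  have hgeo : ∀ k, ∑ j ∈ Finset.range k, (1 / 2 : ℝ) ^ (j + 2) ≤ 1 / 2 := by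
    intro k
    simp_rw [pow_add, ← Finset.sum_mul]
    have := sum_geometric_two_le k
    linarith
  -- The rows of `L` sum to at most 1/2, so the bound 2B reproduces itself: B + (1/2)(2B) = 2B.
  have ha : ∀ k, |a k| ≤ 2 * B := by
    intro k
    induction k using Nat.strong_induction_on with
    | _ k ih =>
      have h1 : |∑ j ∈ Finset.range k, L k j * a j| ≤ B := by
        calc |∑ j ∈ Finset.range k, L k j * a j|
            ≤ ∑ j ∈ Finset.range k, |L k j * a j| := Finset.abs_sum_le_sum_abs _ _
          _ ≤ ∑ j ∈ Finset.range k, (1 / 2) ^ (j + 2) * (2 * B) := by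
              refine Finset.sum_le_sum fun j hj => ?_
              rw [Finset.mem_range] at hj
              rw [abs_mul]
              exact mul_le_mul (hL k j hj) (ih j hj) (abs_nonneg _) (by positivity)
          _ ≤ 1 / 2 * (2 * B) := by
              rw [← Finset.sum_mul]
              exact mul_le_mul_of_nonneg_right (hgeo k) (by positivity)
          _ = B := by ring
      rw [hab k]
      calc _ ≤ |b k| + |∑ j ∈ Finset.range k, L k j * a j| := abs_sub _ _
        _ ≤ 2 * B := by linarith [hB k]
  -- Padded by zeros, the sums become series with a common summable majorant whose terms tend to 0
  -- because the columns of `L` do.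
  have hlim : Tendsto (fun k => ∑' j, if j < k then L k j * a j else 0) atTop
      (𝓝 (∑' _ : ℕ, (0 : ℝ))) := by
    refine tendsto_tsum_of_dominated_convergence
      (bound := fun j => (1 / 2 : ℝ) ^ (j + 2) * (2 * B)) ?_ ?_ ?_
    · simp_rw [pow_add]
      exact (summable_geometric_two.mul_right _).mul_right _
    · intro j
      have : Tendsto (fun k => L k j * a j) atTop (𝓝 0) := by
        simpa using (hL0 j).mul_const (a j)
      refine this.congr' ?_
      filter_upwards [eventually_gt_atTop j] with k hk
      rw [if_pos hk]
    · refine Eventually.of_forall fun k j => ?_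
      split_ifs with h
      · rw [Real.norm_eq_abs, abs_mul]
        exact mul_le_mul (hL k j h) (ha j) (abs_nonneg _) (by positivity)
      · rw [norm_zero]; positivity
  have hsum : ∀ k, ∑' j, (if j < k then L k j * a j else 0)
      = ∑ j ∈ Finset.range k, L k j * a j := by
    intro k
    rw [tsum_eq_sum (s := Finset.range k)]
    · exact Finset.sum_congr rfl fun j hj => if_pos (Finset.mem_range.1 hj)
    · intro j hj
      exact if_neg (by simpa using hj)
  simp_rw [hsum, tsum_zero] at hlim
  have := hb.sub hlim
  rw [sub_zero] at this
  exact this.congr fun k => (hab k).symm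

/-- At most one `f k` is nonzero at `x`. The index depends on `x` but not on `a`, so the sum is
linear in `a` and depends on a single coordinate of `a`. -/
theorem hasSum_mul_of_disjoint {X : Type*} {f : ℕ → X → ℝ} (hdisj : ∀ i j, i ≠ j → ∀ x, f i x * f j x = 0)
    (x : X) : ∃ k, ∀ a : ℕ → ℝ, HasSum (fun j => a j * f j x) (a k * f k x) := by
  by_cases h : ∃ k, f k x ≠ 0
  · obtain ⟨k, hk⟩ := h
    refine ⟨k, fun a => hasSum_single k fun j hj => ?_⟩
    have := hdisj j k hj x
    rw [(mul_eq_zero.1 this).resolve_right hk, mul_zero]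
  · push Not at h
    exact ⟨0, fun a => by simp [h, hasSum_zero]⟩

section Biorthogonal

variable {X : Type*} [TopologicalSpace X]

/-- Biorthogonalisation of finitely supported measures against functions. -/
noncomputable def biorth (ν : ℕ → X →₀ ℝ) (f : ℕ → C(X, ℝ)) : ℕ → X →₀ ℝ
  | k => ν k - ∑ j : Fin k, fpair (ν k) (f j) • biorth ν f j

theorem fpair_biorth (ν : ℕ → X →₀ ℝ) (f : ℕ → C(X, ℝ)) (k : ℕ) (g : X → ℝ) :
    fpair (biorth ν f k) g =
      fpair (ν k) g - ∑ j ∈ Finset.range k, fpair (ν k) (f j) * fpair (biorth ν f j) g := by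
  rw [biorth, fpair_sub_left, fpair_sum_left, Finset.sum_range]
  simp_rw [fpair_smul_left]

/-- Forward elimination: subtracting earlier biorthogonal measures clears the entries below the
diagonal, and those above it vanish already. -/
theorem fpair_biorth_apply {ν : ℕ → X →₀ ℝ} {f : ℕ → C(X, ℝ)}
    (hdiag : ∀ k, fpair (ν k) (f k) = 1) (hupper : ∀ k j, k < j → fpair (ν k) (f j) = 0)
    (k j : ℕ) : fpair (biorth ν f k) (f j) = if j = k then 1 else 0 := by
  induction k using Nat.strong_induction_on with
  | _ k ih =>
    rw [fpair_biorth]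
    rw [Finset.sum_congr rfl fun i hi => by rw [ih i (Finset.mem_range.1 hi)]]
    simp only [mul_ite, mul_one, mul_zero, Finset.sum_ite_eq, Finset.mem_range]
    rcases lt_trichotomy j k with h | h | h
    · simp [h, h.ne]
    · subst h; simp [hdiag]
    · simp [h.ne', h.not_gt, hupper k j h]

/-- The convergence is uniform: the tail at any point is a single term `a k * f k x` with large `k`.
-/
theorem continuous_tsum_of_disjoint {f : ℕ → C(X, ℝ)}
    (hdisj : ∀ i j, i ≠ j → ∀ x, f i x * f j x = 0) {C : ℝ} (hC : ∀ k x, |f k x| ≤ C)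
    {a : ℕ → ℝ} (ha : Tendsto a atTop (𝓝 0)) : Continuous fun x => ∑' j, a j * f j x := by
  have hC0 : 0 ≤ |C| := abs_nonneg _
  have hlim : TendstoUniformly (fun N x => ∑ j ∈ Finset.range N, a j * f j x)
      (fun x => ∑' j, a j * f j x) atTop := by
    rw [Metric.tendstoUniformly_iff]
    intro ε hε
    have h1 : ∀ᶠ k in atTop, |a k| < ε / (|C| + 1) := by
      have := (tendsto_zero_iff_abs_tendsto_zero a).1 ha
      exact this.eventually (gt_mem_nhds (by positivity))
    obtain ⟨N, hN⟩ := eventually_atTop.1 h1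
    filter_upwards [eventually_ge_atTop N] with n hn x
    obtain ⟨k, hk⟩ := hasSum_mul_of_disjoint (f := fun j x => f j x) hdisj x
    have h2 : ∑ j ∈ Finset.range n, a j * f j x = (if k < n then a k else 0) * f k x := by
      have h3 := hk fun j => if j < n then a j else 0
      have h4 : HasSum (fun j => (if j < n then a j else 0) * f j x)
          (∑ j ∈ Finset.range n, a j * f j x) := by
        have h5 : HasSum (fun j => (if j < n then a j else 0) * f j x)
            (∑ j ∈ Finset.range n, (if j < n then a j else 0) * f j x) :=
          hasSum_sum_of_ne_finset_zero fun j hj => by simp_all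
        convert h5 using 1
        exact Finset.sum_congr rfl fun j hj => by simp [Finset.mem_range.1 hj]
      exact h4.unique h3
    rw [(hk a).tsum_eq, h2, Real.dist_eq, ← sub_mul, abs_mul]
    split_ifs with h
    · simpa using hε
    · rw [sub_zero]
      calc |a k| * |f k x| ≤ ε / (|C| + 1) * |C| := by
            exact mul_le_mul (hN k (by omega)).le ((hC k x).trans (le_abs_self C)) (abs_nonneg _)
              (by positivity)
        _ < ε := by
            rw [div_mul_eq_mul_div, div_lt_iff₀ (by positivity)]
            nlinarith
  exact hlim.continuous (Frequently.of_forall fun N => by fun_prop)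

/-- A disjoint bounded sequence of functions and an almost biorthogonal null sequence of finitely
supported measures yield a complemented copy of `(c₀)ₚ`. -/
theorem containsComplementedCopy_of_disjoint {ν : ℕ → X →₀ ℝ} {f : ℕ → C(X, ℝ)} {C : ℝ}
    (hdisj : ∀ i j, i ≠ j → ∀ x, f i x * f j x = 0) (hC : ∀ k x, |f k x| ≤ C)
    (hdiag : ∀ k, fpair (ν k) (f k) = 1) (hupper : ∀ k j, k < j → fpair (ν k) (f j) = 0)
    (hlower : ∀ k j, j < k → |fpair (ν k) (f j)| ≤ (1 / 2) ^ (j + 2))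
    (hnull : ∀ g : C(X, ℝ), Tendsto (fun k => fpair (ν k) g) atTop (𝓝 0)) :
    ContainsComplementedCopy (Cp X ℝ) c0p := by
  -- `P` integrates against the biorthogonal measures and `S` below sums the series of `f j`;
  -- biorthogonality gives `P ∘ S = id`.
  let P : Cp X ℝ →L[ℝ] c0p :=
    { toFun := fun g => ⟨fun k => fpair (biorth ν f k) g,
        tendsto_zero_of_triangular (fun k => fpair_biorth ν f k g) hlower (fun j => hnull (f j))
          (hnull ⟨g, g.2⟩)⟩
      map_add' := fun g h => Subtype.ext <| funext fun k => fpair_add_right _ _ _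
      map_smul' := fun c g => Subtype.ext <| funext fun k => fpair_smul_right _ _ _
      cont := by
        refine Continuous.subtype_mk (continuous_pi fun k => ?_) _
        exact continuous_finsetSum _ fun x _ =>
          continuous_const.mul ((continuous_apply x).comp continuous_subtype_val) }
  have hs := hasSum_mul_of_disjoint (f := fun j x => f j x) hdisj
  let S : c0p →L[ℝ] Cp X ℝ :=
    { toFun := fun a => ⟨fun x => ∑' j, a.1 j * f j x, continuous_tsum_of_disjoint hdisj hC a.2⟩
      map_add' := fun a b => Subtype.ext <| funext fun x => by
        obtain ⟨k, hk⟩ := hs x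
        have h1 := (hk a.1).tsum_eq
        have h2 := (hk b.1).tsum_eq
        have h3 := (hk (a.1 + b.1)).tsum_eq
        simp only [Submodule.coe_add, Pi.add_apply] at h1 h2 h3 ⊢
        rw [h1, h2, h3, add_mul]
      map_smul' := fun c a => Subtype.ext <| funext fun x => by
        obtain ⟨k, hk⟩ := hs x
        have h1 := (hk a.1).tsum_eq
        have h3 := (hk (c • a.1)).tsum_eq
        simp only [Submodule.coe_smul, Pi.smul_apply, smul_eq_mul, RingHom.id_apply] at h1 h3 ⊢
        rw [h1, h3, mul_assoc]
      cont := by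
        refine Continuous.subtype_mk (continuous_pi fun x => ?_) _
        obtain ⟨k, hk⟩ := hs x
        simp_rw [fun a : c0p => (hk a.1).tsum_eq]
        exact ((continuous_apply k).comp continuous_subtype_val).mul continuous_const }
  refine ContainsComplementedCopy.of_leftInverse P S fun a => Subtype.ext <| funext fun k => ?_
  change fpair (biorth ν f k) (fun x => ∑' j, a.1 j * f j x) = a.1 k
  have h1 : HasSum (fun j => ∑ x ∈ (biorth ν f k).support, biorth ν f k x * (a.1 j * f j x))
      (fpair (biorth ν f k) (fun x => ∑' j, a.1 j * f j x)) := by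
    refine hasSum_sum fun x _ => HasSum.mul_left _ ?_
    obtain ⟨m, hm⟩ := hs x
    exact (hm a.1).summable.hasSum
  have h2 : ∀ j, ∑ x ∈ (biorth ν f k).support, biorth ν f k x * (a.1 j * f j x) =
      if j = k then a.1 j else 0 := by
    intro j
    have := fpair_smul_right (biorth ν f k) (a.1 j) (f j)
    rw [fpair_biorth_apply hdiag hupper, mul_ite, mul_one, mul_zero] at this
    exact this
  simp_rw [h2] at h1
  exact h1.unique (hasSum_ite_eq k (a.1 k) |>.congr_fun fun j => by
    split_ifs with h
    · rw [h]
    · rfl)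

end Biorthogonal

/-! ### Gliding hump: weakly null measures are null in variation -/

section GlidingHump

variable {X : Type*} [TopologicalSpace X] [CompactSpace X] [T2Space X]

/-- The total mass of the atoms of a limit of finitely supported positive measures is finite, so
the mass close to a finite set of points is uniformly small outside a finite set. -/
theorem exists_finset_small_nhds {ν : ℕ → X →₀ ℝ} {M : ℝ} (hM : ∀ n, fvar (ν n) univ ≤ M) :
    ∃ lim : Set X → ℝ, (∀ K, Tendsto (fun n => fvar (ν n) K) (hyperfilter ℕ) (𝓝 (lim K))) ∧
      ∀ ε > 0, ∃ H : Finset X, ∀ G : Finset X, Disjoint G H → ∀ O : Set X, IsOpen O → ↑G ⊆ O →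
        ∃ K : Set X, IsClosed K ∧ ↑G ⊆ interior K ∧ K ⊆ O ∧ lim K < ε := by
  classical
  -- Limits along a free ultrafilter exist for all sets at once, with no passage to a subsequence.
  have hlim : ∀ K : Set X, ∃ l, Tendsto (fun n => fvar (ν n) K) (hyperfilter ℕ) (𝓝 l) := by
    intro K
    have hmem : ∀ n, fvar (ν n) K ∈ Icc 0 M := fun n =>
      ⟨fvar_nonneg _ _, (fvar_mono _ fun _ _ _ => mem_univ _).trans (hM n)⟩
    obtain ⟨l, -, hl⟩ := isCompact_Icc.ultrafilter_le_nhds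
      ((hyperfilter ℕ).map fun n => fvar (ν n) K)
      (by
        rw [le_principal_iff, Ultrafilter.coe_map, mem_map]
        exact univ_mem' hmem)
    exact ⟨l, hl⟩
  choose lim hlim using hlim
  have hnonneg : ∀ K, 0 ≤ lim K := fun K =>
    ge_of_tendsto' (hlim K) fun n => fvar_nonneg _ _
  have hmono : ∀ K L, K ⊆ L → lim K ≤ lim L := fun K L h =>
    le_of_tendsto_of_tendsto' (hlim K) (hlim L) fun n => fvar_mono _ fun _ _ hx => h hx
  let atom : X → ℝ := fun x => sInf (lim '' {K | IsClosed K ∧ K ∈ 𝓝 x})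
  have hbdd : ∀ x, BddBelow (lim '' {K | IsClosed K ∧ K ∈ 𝓝 x}) := fun x =>
    ⟨0, by rintro _ ⟨K, -, rfl⟩; exact hnonneg K⟩
  have hne : ∀ x, (lim '' {K | IsClosed K ∧ K ∈ 𝓝 x}).Nonempty := fun x =>
    ⟨_, univ, ⟨isClosed_univ, univ_mem⟩, rfl⟩
  have hatom0 : ∀ x, 0 ≤ atom x := fun x => le_csInf (hne x) (by
    rintro _ ⟨K, -, rfl⟩; exact hnonneg K)
  have hatom_le : ∀ x K, IsClosed K → K ∈ 𝓝 x → atom x ≤ lim K := fun x K h1 h2 =>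
    csInf_le (hbdd x) ⟨K, ⟨h1, h2⟩, rfl⟩
  have hatom_lt : ∀ x, ∀ ε > 0, ∀ O : Set X, IsOpen O → x ∈ O →
      ∃ K, IsClosed K ∧ K ∈ 𝓝 x ∧ K ⊆ O ∧ lim K < atom x + ε := by
    intro x ε hε O hO hx
    obtain ⟨_, ⟨K, ⟨h1, h2⟩, rfl⟩, h3⟩ := exists_lt_of_csInf_lt (hne x)
      (show sInf _ < atom x + ε from lt_add_of_pos_right _ hε)
    obtain ⟨L, hL1, hL2, hL3⟩ := exists_mem_nhds_isClosed_subset (hO.mem_nhds hx)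
    exact ⟨K ∩ L, h1.inter hL2, inter_mem h2 hL1, inter_subset_right.trans hL3,
      (hmono _ _ inter_subset_left).trans_lt h3⟩
  -- Distinct points have disjoint closed neighbourhoods, whose variations add up to at most `M`.
  have hsum : ∀ J : Finset X, ∑ x ∈ J, atom x ≤ M := by
    intro J
    obtain ⟨U, hU, hdisj⟩ := J.finite_toSet.t2_separation
    choose K hK1 hK2 hK3 _ using fun x => hatom_lt x 1 one_pos (U x) (hU x).2 (hU x).1
    calc ∑ x ∈ J, atom x ≤ ∑ x ∈ J, lim (K x) :=
          Finset.sum_le_sum fun x _ => hatom_le x _ (hK1 x) (hK2 x)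
      _ ≤ M := by
          refine le_of_tendsto' (tendsto_finsetSum J fun x _ => hlim (K x)) fun n => ?_
          refine (sum_fvar_le (ν n) J K ?_).trans (hM n)
          exact fun x hx y hy hxy => (hdisj hx hy hxy).mono (hK3 x) (hK3 y)
  have hsummable : Summable atom := summable_of_sum_le hatom0 hsum
  refine ⟨lim, hlim, fun ε hε => ?_⟩
  obtain ⟨H, hH⟩ := summable_iff_vanishing_norm.1 hsummable (ε / 2) (by positivity)
  refine ⟨H, fun G hG O hO hGO => ?_⟩
  -- Half of `ε` pays for the atoms in `G`, the other half for the excess over them at the points of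
  -- `G`; the `+ 1` covers empty `G`.
  have hδ : 0 < ε / 2 / (G.card + 1) := by positivity
  choose! K hK1 hK2 hK3 hK4 using fun x (hx : x ∈ O) => hatom_lt x _ hδ O hO hx
  refine ⟨⋃ x ∈ G, K x, ?_, fun x hx => ?_, ?_, ?_⟩
  · exact Set.Finite.isClosed_biUnion G.finite_toSet fun x hx => hK1 x (hGO hx)
  · rw [mem_interior_iff_mem_nhds]
    exact mem_of_superset (hK2 x (hGO hx)) (subset_biUnion_of_mem (u := fun x => K x) hx)
  · exact iUnion₂_subset fun x hx => hK3 x (hGO hx)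
  · calc lim (⋃ x ∈ G, K x) ≤ ∑ x ∈ G, lim (K x) :=
          le_of_tendsto_of_tendsto' (hlim _) (tendsto_finsetSum G fun x _ => hlim (K x))
            fun n => fvar_biUnion_le _ _ _
      _ ≤ ∑ x ∈ G, (atom x + ε / 2 / (G.card + 1)) :=
          Finset.sum_le_sum fun x hx => (hK4 x (hGO hx)).le
      _ = ∑ x ∈ G, atom x + G.card * (ε / 2 / (G.card + 1)) := by
          rw [Finset.sum_add_distrib, Finset.sum_const, nsmul_eq_mul]
      _ < ε / 2 + ε / 2 := by
          refine add_lt_add_of_lt_of_le ((le_abs_self _).trans_lt (hH G hG)) ?_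
          rw [mul_div_assoc', div_le_iff₀ (by positivity)]
          nlinarith
      _ = ε := by ring

/-- Inductively, a late measure has little mass on the earlier supports and on the exceptional set
`H`. Its remaining support points get a closed neighbourhood, off the earlier supports, of small
limit mass, so that later measures nearly miss it. -/
theorem exists_almost_disjoint_subsequence {ν : ℕ → X →₀ ℝ} {M : ℝ}
    (hM : ∀ n, fvar (ν n) univ ≤ M) (hge : ∀ n, 3 / 4 ≤ fvar (ν n) univ)
    (hnull : ∀ x, Tendsto (fun n => ν n x) atTop (𝓝 0)) :
    ∃ (n : ℕ → ℕ) (K : ℕ → Set X), StrictMono n ∧ (∀ k, IsClosed (K k)) ∧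
      (∀ k, 11 / 16 ≤ fvar (ν (n k)) (interior (K k))) ∧
      (∀ j k, j < k → fvar (ν (n k)) (K j) ≤ (1 / 2) ^ (j + 4)) ∧
      ∀ j k, j < k → ∀ x ∈ (ν (n j)).support, x ∉ K k := by
  classical
  obtain ⟨lim, hlim, hsmall⟩ := exists_finset_small_nhds hM
  have hle : (hyperfilter ℕ : Filter ℕ) ≤ atTop := by
    rw [← Nat.cofinite_eq_atTop]; exact hyperfilter_le_cofinite
  obtain ⟨t, ht1, ht2⟩ := exists_seq_of_forall_finset_exists
    (α := ℕ × ℕ × Set X)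
    (fun t => IsClosed t.2.2 ∧ 11 / 16 ≤ fvar (ν t.2.1) (interior t.2.2) ∧
      lim t.2.2 < (1 / 2) ^ (t.1 + 4))
    (fun t u => t.1 < u.1 ∧ t.2.1 < u.2.1 ∧ fvar (ν u.2.1) t.2.2 ≤ (1 / 2) ^ (t.1 + 4) ∧
      ∀ x ∈ (ν t.2.1).support, x ∉ u.2.2) (by
    intro s hs
    -- The inductive choice does not see its own position, so each triple carries a counter; it
    -- increases strictly, hence is at least the position.
    let i := s.sup (fun t => t.1) + 1
    let past : Finset X := s.biUnion fun t => (ν t.2.1).support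
    obtain ⟨H, hH⟩ := hsmall ((1 / 2) ^ (i + 4)) (by positivity)
    -- The loss of 1/16 from 3/4 leaves the 11/16 demanded on the interior of `K`.
    have e1 : ∀ᶠ n in (hyperfilter ℕ : Filter ℕ), fvar (ν n) ((past ∪ H : Finset X) : Set X) < 1 / 16 :=
      hle ((tendsto_fvar_finset hnull _).eventually (gt_mem_nhds (by norm_num)))
    have e2 : ∀ᶠ n in (hyperfilter ℕ : Filter ℕ), ∀ t ∈ s, fvar (ν n) t.2.2 < (1 / 2) ^ (t.1 + 4) :=
      (Finset.eventually_all s).2 fun t ht => (hlim _).eventually (gt_mem_nhds (hs t ht).2.2)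
    have e3 : ∀ᶠ n in (hyperfilter ℕ : Filter ℕ), s.sup (fun t => t.2.1) < n :=
      hle (eventually_gt_atTop _)
    obtain ⟨n, h1, h2, h3⟩ := (e1.and (e2.and e3)).exists
    obtain ⟨K, hK1, hK2, hK3, hK4⟩ := hH ((ν n).support \ (past ∪ H))
      (Finset.disjoint_left.2 fun x hx hxH => by simp [hxH] at hx) (past : Set X)ᶜ
      past.finite_toSet.isClosed.isOpen_compl (fun x hx => by simp at hx ⊢; tauto)
    refine ⟨(i, n, K), ⟨hK1, ?_, hK4⟩, fun t ht => ⟨?_, ?_, (h2 t ht).le, fun x hx hxK => ?_⟩⟩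
    · have h4 : fvar (ν n) univ ≤
          fvar (ν n) ((past ∪ H : Finset X) : Set X) + fvar (ν n) (interior K) := by
        refine le_trans (fvar_mono _ fun x hx _ => ?_) (fvar_union_le _ _ _)
        by_cases hxp : x ∈ past ∪ H
        · exact Or.inl hxp
        · exact Or.inr (hK2 (by simp only [Finset.coe_sdiff]; exact ⟨hx, hxp⟩))
      have h5 := hge n
      simp only
      linarith
    · exact Nat.lt_succ_of_le (Finset.le_sup (f := fun t : ℕ × ℕ × Set X => t.1) ht)
    · exact (Finset.le_sup (f := fun t : ℕ × ℕ × Set X => t.2.1) ht).trans_lt h3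
    · exact hK3 hxK (Finset.mem_coe.2 (Finset.mem_biUnion.2 ⟨t, ht, hx⟩)))
  have hmono : StrictMono fun k => (t k).1 := strictMono_nat_of_lt_succ fun k =>
    (ht2 k (k + 1) (Nat.lt_succ_self k)).1
  refine ⟨fun k => (t k).2.1, fun k => (t k).2.2, ?_, fun k => (ht1 k).1, fun k => (ht1 k).2.1,
    fun j k hjk => ?_, fun j k hjk => (ht2 j k hjk).2.2.2⟩
  · exact strictMono_nat_of_lt_succ fun k => (ht2 k (k + 1) (Nat.lt_succ_self k)).2.1
  · refine (ht2 j k hjk).2.2.1.trans (pow_le_pow_of_le_one (by norm_num) (by norm_num) ?_)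
    have := hmono.id_le j
    simp only [id_eq] at this
    omega

/-- Cutting the earlier sets out of the interiors leaves disjoint open sets with mass at least 11/16
- 1/8 > 1/2. Normalised norming functions on them have norm at most 2 and form, with the measures, a
nearly lower triangular system with small entries. -/
theorem containsComplementedCopy_of_coordinatewise_null {ν : ℕ → X →₀ ℝ} {M : ℝ}
    (hM : ∀ n, fvar (ν n) univ ≤ M) (hge : ∀ n, 3 / 4 ≤ fvar (ν n) univ)
    (hnull : ∀ x, Tendsto (fun n => ν n x) atTop (𝓝 0))
    (hweak : ∀ g : C(X, ℝ), Tendsto (fun k => fpair (ν k) g) atTop (𝓝 0)) :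
    ContainsComplementedCopy (Cp X ℝ) c0p := by
  classical
  obtain ⟨n, K, hn, hK, hint, hsmall, hsupp⟩ := exists_almost_disjoint_subsequence hM hge hnull
  let V : ℕ → Set X := fun k => interior (K k) \ ⋃ j ∈ Finset.range k, K j
  have hVopen : ∀ k, IsOpen (V k) := fun k => isOpen_interior.sdiff
    (Set.Finite.isClosed_biUnion (Finset.range k).finite_toSet fun j _ => hK j)
  have hVK : ∀ k, V k ⊆ K k := fun k => sdiff_subset.trans interior_subset
  have hVdisj : ∀ j k, j < k → ∀ x, x ∈ V j → x ∉ V k := by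
    intro j k hjk x hxj hxk
    exact hxk.2 (mem_iUnion₂.2 ⟨j, Finset.mem_range.2 hjk, hVK j hxj⟩)
  have hV : ∀ k, 1 / 2 ≤ fvar (ν (n k)) (V k) := by
    intro k
    have h1 : fvar (ν (n k)) (interior (K k)) ≤
        fvar (ν (n k)) (V k) + fvar (ν (n k)) (⋃ j ∈ Finset.range k, K j) := by
      refine le_trans (fvar_mono _ fun x _ hx => ?_) (fvar_union_le _ _ _)
      by_cases hxp : x ∈ ⋃ j ∈ Finset.range k, K j
      · exact Or.inr hxp
      · exact Or.inl ⟨hx, hxp⟩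
    have h2 : fvar (ν (n k)) (⋃ j ∈ Finset.range k, K j) ≤ 1 / 8 := by
      calc _ ≤ ∑ j ∈ Finset.range k, fvar (ν (n k)) (K j) := fvar_biUnion_le _ _ _
        _ ≤ ∑ j ∈ Finset.range k, (1 / 2 : ℝ) ^ (j + 4) :=
            Finset.sum_le_sum fun j hj => hsmall j k (Finset.mem_range.1 hj)
        _ ≤ 1 / 8 := by
            simp_rw [pow_add, ← Finset.sum_mul]
            have := sum_geometric_two_le k
            linarith
    have h3 := hint k
    linarith
  choose f hf1 hf2 hf3 using fun k => exists_continuous_norming (ν (n k)) (hVopen k)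
  let c : ℕ → ℝ := fun k => (fvar (ν (n k)) (V k))⁻¹
  have hc0 : ∀ k, 0 < fvar (ν (n k)) (V k) := fun k => lt_of_lt_of_le (by norm_num) (hV k)
  have hc : ∀ k, |c k| ≤ 2 := by
    intro k
    rw [abs_of_pos (inv_pos.2 (hc0 k))]
    exact inv_le_of_inv_le₀ (by norm_num) (by linarith [hV k])
  have hb : ∀ k x, |(c k • f k) x| ≤ 2 := by
    intro k x
    rw [ContinuousMap.smul_apply, smul_eq_mul, abs_mul]
    nlinarith [hc k, hf1 k x, abs_nonneg (c k), abs_nonneg (f k x)]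
  refine containsComplementedCopy_of_disjoint (ν := fun k => ν (n k)) (f := fun k => c k • f k)
    (C := 2) ?_ hb ?_ ?_ ?_ fun g => (hweak g).comp hn.tendsto_atTop
  · have key : ∀ i j, i < j → ∀ x, f i x * f j x = 0 := by
      intro i j hij x
      by_cases hx : x ∈ V i
      · rw [hf2 j x (hVdisj i j hij x hx), mul_zero]
      · rw [hf2 i x hx, zero_mul]
    intro i j hij x
    have : f i x * f j x = 0 := by
      rcases lt_or_gt_of_ne hij with h | h
      · exact key i j h x
      · rw [mul_comm]; exact key j i h x
    simp only [ContinuousMap.smul_apply, smul_eq_mul]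
    linear_combination (c i * c j) * this
  · intro k
    rw [ContinuousMap.coe_smul, fpair_smul_right, hf3]
    exact inv_mul_cancel₀ (hc0 k).ne'
  · intro k j hkj
    refine fpair_eq_zero _ fun x hx => ?_
    rw [ContinuousMap.smul_apply, hf2 j x fun h => hsupp k j hkj x hx (hVK j h), smul_zero]
  · intro k j hjk
    calc _ ≤ 2 * fvar (ν (n k)) (K j) := by
          refine abs_fpair_le _ _ _ _ (fun x _ => hb j x) fun x _ hx => ?_
          rw [ContinuousMap.smul_apply, hf2 j x fun h => hx (hVK j h), smul_zero]
      _ ≤ 2 * (1 / 2) ^ (j + 4) := by linarith [hsmall j k hjk]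
      _ ≤ (1 / 2) ^ (j + 2) := by
          rw [pow_add, pow_add]
          have : (0 : ℝ) < (1 / 2) ^ j := by positivity
          nlinarith

/-- If `C_p(X)` has no complemented copy of `(c₀)ₚ`, a sequence of finitely supported measures
which converges to `0` pointwise on `C(X)` converges to `0` in variation. -/
theorem tendsto_fvar_of_tendsto_fpair (hX : ¬ ContainsComplementedCopy (Cp X ℝ) c0p)
    {μ : ℕ → X →₀ ℝ} (hμ : ∀ g : C(X, ℝ), Tendsto (fun k => fpair (μ k) g) atTop (𝓝 0)) :
    Tendsto (fun n => fvar (μ n) univ) atTop (𝓝 0) := by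
  classical
  by_contra hnot
  apply hX
  obtain ⟨δ, hδ, hfreq⟩ : ∃ δ > 0, ∃ᶠ n in atTop, δ ≤ fvar (μ n) univ := by
    rw [Metric.tendsto_nhds] at hnot
    push Not at hnot
    obtain ⟨δ, hδ, h⟩ := hnot
    refine ⟨δ, hδ, h.mono fun n hn => ?_⟩
    simpa [abs_of_nonneg (fvar_nonneg _ _)] using hn
  obtain ⟨φ, hφ, hφδ⟩ := extraction_of_frequently_atTop hfreq
  -- Along this subsequence the variations are at least `δ`, so normalising preserves convergence to
  -- 0 on C(X).
  let ρ : ℕ → X →₀ ℝ := fun n => (fvar (μ (φ n)) univ)⁻¹ • μ (φ n)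
  have hpos : ∀ n, 0 < fvar (μ (φ n)) univ := fun n => hδ.trans_le (hφδ n)
  have hρ1 : ∀ n, fvar (ρ n) univ = 1 := fun n => by
    rw [fvar_smul, abs_of_pos (inv_pos.2 (hpos n)), inv_mul_cancel₀ (hpos n).ne']
  have hρw : ∀ g : C(X, ℝ), Tendsto (fun k => fpair (ρ k) g) atTop (𝓝 0) := by
    intro g
    have h1 : Tendsto (fun k => δ⁻¹ * |fpair (μ (φ k)) g|) atTop (𝓝 0) := by
      have := (((hμ g).comp hφ.tendsto_atTop).abs).const_mul δ⁻¹
      simpa using this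
    refine squeeze_zero_norm (fun k => ?_) h1
    rw [fpair_smul_left, Real.norm_eq_abs, abs_mul, abs_of_pos (inv_pos.2 (hpos k))]
    exact mul_le_mul_of_nonneg_right (inv_anti₀ hδ (hφδ k)) (abs_nonneg _)
  have hcoord : ∀ n x, |ρ n x| ≤ 1 := by
    intro n x
    by_cases hx : x ∈ (ρ n).support
    · rw [← hρ1 n, fvar_univ]
      exact Finset.single_le_sum (f := fun x => |ρ n x|) (fun _ _ => abs_nonneg _) hx
    · simp [Finsupp.notMem_support_iff.1 hx]
  -- a coordinatewise convergent subsequence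
  let S : Set X := ⋃ n, ((ρ n).support : Set X)
  have hS : S.Countable := countable_iUnion fun n => (ρ n).support.countable_toSet
  have : Countable S := hS.to_subtype
  have hcpt : IsCompact (Set.pi univ fun _ : S => Icc (-1 : ℝ) 1) :=
    isCompact_univ_pi fun _ => isCompact_Icc
  obtain ⟨y, -, ψ, hψ, hlim⟩ := hcpt.tendsto_subseq (x := fun n (s : S) => ρ n s)
    (fun n s _ => abs_le.1 (hcoord n s))
  have hconv : ∀ x, ∃ l, Tendsto (fun n => ρ (ψ n) x) atTop (𝓝 l) := by
    intro x
    by_cases hx : x ∈ S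
    · exact ⟨y ⟨x, hx⟩, (tendsto_pi_nhds.1 hlim) ⟨x, hx⟩⟩
    · refine ⟨0, tendsto_const_nhds.congr fun n => ?_⟩
      have : x ∉ (ρ (ψ n)).support := fun h => hx (mem_iUnion.2 ⟨_, h⟩)
      exact (Finsupp.notMem_support_iff.1 this).symm
  -- differences which stay away from zero
  have hstep : ∀ N, ∃ m, N < m ∧ 3 / 4 ≤ fvar (ρ (ψ m) - ρ (ψ N)) univ := by
    intro N
    -- The integral of `f` is 1 for the measure at `N` and below 1/4 for a late one, so the
    -- difference has variation at least 3/4.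
    obtain ⟨f, hf1, -, hf3⟩ := exists_continuous_norming (ρ (ψ N)) isOpen_univ
    have h1 := ((hρw f).comp hψ.tendsto_atTop).eventually
      (gt_mem_nhds (show (0 : ℝ) < 1 / 4 by norm_num))
    obtain ⟨m, hm1, hm2⟩ := (h1.and (eventually_gt_atTop N)).exists
    refine ⟨m, hm2, ?_⟩
    have h2 := abs_fpair_le (ρ (ψ m) - ρ (ψ N)) f univ 1 (fun x _ => hf1 x)
      (fun x _ h => absurd (mem_univ x) h)
    rw [fpair_sub_left, hf3, hρ1, one_mul] at h2
    have h3 := neg_abs_le (fpair (ρ (ψ m)) f - 1)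
    simp only [Function.comp_apply] at hm1
    linarith
  choose m hm1 hm2 using hstep
  have hm : Tendsto m atTop atTop := tendsto_atTop_mono (fun n => (hm1 n).le) tendsto_id
  refine containsComplementedCopy_of_coordinatewise_null (M := 2)
    (ν := fun n => ρ (ψ (m n)) - ρ (ψ n)) (fun n => ?_) hm2 (fun x => ?_) fun g => ?_
  · refine (fvar_sub_le _ _ _).trans ?_
    rw [hρ1, hρ1]; norm_num
  · obtain ⟨l, hl⟩ := hconv x
    simpa using (hl.comp hm).sub hl
  · simp_rw [fpair_sub_left]
    have h1 := (hρw g).comp hψ.tendsto_atTop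
    simpa using (h1.comp hm).sub h1

end GlidingHump

/-! ### Test functions vanishing on a finite set -/

section VanishingOnFinite

variable {X : Type*} [TopologicalSpace X] [CompactSpace X] [T2Space X]

/-- As `tendsto_fvar_of_tendsto_fpair`, for measures off a finite set tested only on functions
vanishing on that set. -/
theorem tendsto_fvar_of_tendsto_fpair_of_vanishing
    (hX : ¬ ContainsComplementedCopy (Cp X ℝ) c0p) {σ : ℕ → X →₀ ℝ} (B : Finset X)
    (hB : ∀ n, ∀ x ∈ B, σ n x = 0)
    (hσ : ∀ g : C(X, ℝ), (∀ x ∈ B, g x = 0) →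
      Tendsto (fun k => fpair (σ k) g) atTop (𝓝 0)) :
    Tendsto (fun n => fvar (σ n) univ) atTop (𝓝 0) := by
  classical
  choose φ hφ1 _ hφ3 _ using fun b : X => exists_continuous_bump B isOpen_univ (mem_univ b)
  -- Point masses on `B` correct `σ n` so that integrating `g` against `α n` amounts to integrating
  -- `g - ∑ g b • φ b`, which vanishes on `B`, against `σ n`. Off `B` nothing changes.
  let α : ℕ → X →₀ ℝ := fun n => σ n - ∑ b ∈ B, Finsupp.single b (fpair (σ n) (φ b))
  have hα : ∀ n (g : C(X, ℝ)), fpair (α n) g =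
      fpair (σ n) (g - ∑ b ∈ B, g b • φ b : C(X, ℝ)) := by
    intro n g
    have h1 : ∀ x, (g - ∑ b ∈ B, g b • φ b : C(X, ℝ)) x = g x - ∑ b ∈ B, g b * φ b x := fun x => by simp
    rw [fpair_sub_left, fpair_sum_left]
    simp_rw [fpair_single, fpair, h1, mul_sub, Finset.sum_sub_distrib, Finset.mul_sum,
      Finset.sum_mul]
    congr 1
    rw [Finset.sum_comm]
    exact Finset.sum_congr rfl fun b _ => Finset.sum_congr rfl fun x _ => by ring
  have hαnull : ∀ g : C(X, ℝ), Tendsto (fun k => fpair (α k) g) atTop (𝓝 0) := by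
    intro g
    simp_rw [hα]
    refine hσ _ fun x hx => ?_
    simp only [ContinuousMap.sub_apply, ContinuousMap.coe_sum, ContinuousMap.coe_smul,
      Finset.sum_apply, Pi.smul_apply, smul_eq_mul]
    rw [Finset.sum_eq_single_of_mem x hx, hφ1, mul_one, sub_self]
    intro b hb hbx
    rw [hφ3 b x hx hbx.symm, mul_zero]
  refine squeeze_zero (fun n => fvar_nonneg _ _) (fun n => ?_)
    (tendsto_fvar_of_tendsto_fpair hX hαnull)
  have hcoord : ∀ x, x ∉ B → α n x = σ n x := by
    intro x hx
    simp only [α, Finsupp.sub_apply, Finsupp.finsetSum_apply]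
    rw [Finset.sum_eq_zero, sub_zero]
    intro b hb
    exact Finsupp.single_eq_of_ne (fun h => hx (h ▸ hb))
  have hsub : (σ n).support ⊆ (α n).support := by
    intro x hx
    rw [Finsupp.mem_support_iff] at hx ⊢
    rwa [hcoord x fun h => hx (hB n x h)]
  rw [fvar_univ, fvar_univ]
  refine le_trans (Finset.sum_le_sum fun x hx => ?_)
    (Finset.sum_le_sum_of_subset_of_nonneg hsub fun _ _ _ => abs_nonneg _)
  rw [hcoord x fun h => (Finsupp.mem_support_iff.1 hx) (hB n x h)]

end VanishingOnFinite

/-! ### Functionals on separately continuous functions -/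

section SeparatelyContinuous

variable {X : Type*} [TopologicalSpace X]

/-- Elements of `C_p(X, C_p(X))` seen as separately continuous functions on `X × X`. -/
def uncurryCp (g : Cp X (Cp X ℝ)) (p : X × X) : ℝ := (g.1 p.1).1 p.2

/-- A separately continuous function on `X × X` as an element of `C_p(X, C_p(X))`. -/
def curryCp (g : X → X → ℝ) (h1 : ∀ x, Continuous (g x)) (h2 : ∀ y, Continuous fun x => g x y) :
    Cp X (Cp X ℝ) :=
  ⟨fun x => ⟨g x, h1 x⟩, Continuous.subtype_mk (continuous_pi h2) _⟩

theorem uncurryCp_curryCp (g : X → X → ℝ) (h1 : ∀ x, Continuous (g x))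
    (h2 : ∀ y, Continuous fun x => g x y) (p : X × X) :
    uncurryCp (curryCp g h1 h2) p = g p.1 p.2 := rfl

theorem continuous_uncurryCp_right (g : Cp X (Cp X ℝ)) (x : X) :
    Continuous fun y => uncurryCp g (x, y) := (g.1 x).2

theorem continuous_uncurryCp_left (g : Cp X (Cp X ℝ)) (y : X) :
    Continuous fun x => uncurryCp g (x, y) :=
  (continuous_apply y).comp (continuous_subtype_val.comp g.2)

/-- Evaluation at a point of `X × X` as a linear functional on `C_p(X, C_p(X))`. -/
def evalCp (p : X × X) : Cp X (Cp X ℝ) →ₗ[ℝ] ℝ where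
  toFun g := uncurryCp g p
  map_add' _ _ := rfl
  map_smul' _ _ := rfl

/-- Continuous functionals for a topology induced by linear functionals are their linear
combinations. -/
theorem exists_finsupp_of_continuous {E ι : Type*} [AddCommGroup E] [Module ℝ E]
    [tE : TopologicalSpace E] (e : ι → E →ₗ[ℝ] ℝ)
    (he : ∀ t : TopologicalSpace E, (∀ i, Continuous[t, inferInstance] (e i)) → t ≤ tE)
    (φ : E →L[ℝ] ℝ) : ∃ m : ι →₀ ℝ, ∀ g, φ g = fpair m fun i => e i g := by
  have h : (φ : E →ₗ[ℝ] ℝ) ∈ Submodule.span ℝ (Set.range e) := by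
    refine (LinearMap.mem_span_iff_continuous _).2 (continuous_le_dom (he _ fun i => ?_) φ.continuous)
    exact continuous_iInf_dom (i := i) continuous_induced_dom
  obtain ⟨m, hm⟩ := (Finsupp.mem_span_range_iff_exists_finsupp).1 h
  refine ⟨m, fun g => ?_⟩
  have h1 := LinearMap.congr_fun hm g
  rw [Finsupp.sum, LinearMap.sum_apply] at h1
  exact h1.symm

/-- Continuous functionals on `C_p(X, C_p(X))` are finitely supported on `X × X`. -/
theorem exists_fpair_eq (φ : Cp X (Cp X ℝ) →L[ℝ] ℝ) :
    ∃ m : X × X →₀ ℝ, ∀ g, φ g = fpair m (uncurryCp g) := by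
  refine exists_finsupp_of_continuous (E := Cp X (Cp X ℝ)) (evalCp (X := X)) (fun t ht => ?_) φ
  refine continuous_iff_le_induced.1 (@continuous_pi _ _ _ t _ _ fun x => ?_)
  exact continuous_induced_rng.2 (@continuous_pi _ _ _ t _ _ fun y => ht (x, y))

end SeparatelyContinuous

/-! ### Reduction to finitely many fibres -/

/-- The solution of a lower triangular system by forward substitution. -/
noncomputable def triangularSolution (d : ℕ → ℕ → ℝ) (b : ℕ → ℝ) : ℕ → ℝ
  | k => (b k - ∑ j : Fin k, triangularSolution d b j * d k j) / d k k

theorem exists_triangular_solution (d : ℕ → ℕ → ℝ) (hd : ∀ k, d k k ≠ 0) (b : ℕ → ℝ) :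
    ∃ c : ℕ → ℝ, ∀ k, ∑ j ∈ Finset.range (k + 1), c j * d k j = b k := by
  refine ⟨triangularSolution d b, fun k => ?_⟩
  rw [Finset.sum_range_succ, triangularSolution, div_mul_cancel₀ _ (hd k), Finset.sum_range]
  ring

section Matching

variable {X : Type*} [TopologicalSpace X] [CompactSpace X] [T2Space X]

/-- Finitely supported measures on `X × X` which are pointwise bounded on the separately
continuous functions are supported by finitely many fibres. -/
theorem exists_finite_fibres {m : ℕ → X × X →₀ ℝ}
    (hm : ∀ g : Cp X (Cp X ℝ), ∃ C, ∀ n, |fpair (m n) (uncurryCp g)| ≤ C) :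
    ∃ A B : Finset X, ∀ n, ∀ p ∈ (m n).support, p.1 ∈ A ∨ p.2 ∈ B := by
  classical
  by_contra hno
  push Not at hno
  let W : Set (X × X) := {p | ∃ n, p ∈ (m n).support}
  have hbasis : ∀ A B : Finset X, ∃ p ∈ W, p.1 ∉ A ∧ p.2 ∉ B := fun A B => by
    obtain ⟨n, p, hp, h⟩ := hno A B
    exact ⟨p, ⟨n, hp⟩, h⟩
  -- Support points off any finitely many fibres generate a proper filter. By compactness an
  -- ultrafilter refining it converges to some `q`, with both coordinates leaving every finite set.
  let l : Filter (X × X) := 𝓟 W ⊓ (comap Prod.fst cofinite ⊓ comap Prod.snd cofinite)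
  have hl : l.NeBot := by
    rw [Filter.inf_neBot_iff]
    intro s hs t ht
    obtain ⟨u, hu, v, hv, huv⟩ := Filter.mem_inf_iff_superset.1 ht
    obtain ⟨u', hu', hu2⟩ := Filter.mem_comap.1 hu
    obtain ⟨v', hv', hv2⟩ := Filter.mem_comap.1 hv
    obtain ⟨p, hp, h1, h2⟩ := hbasis (Set.Finite.toFinset hu') (Set.Finite.toFinset hv')
    refine ⟨p, hs hp, huv ⟨hu2 ?_, hv2 ?_⟩⟩
    · by_contra h
      exact h1 ((Set.Finite.mem_toFinset hu').2 h)
    · by_contra h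
      exact h2 ((Set.Finite.mem_toFinset hv').2 h)
  let 𝒰 : Ultrafilter (X × X) := Ultrafilter.of l
  have h𝒰 : (𝒰 : Filter (X × X)) ≤ l := Ultrafilter.of_le l
  have hW : ∀ᶠ p in (𝒰 : Filter (X × X)), p ∈ W := h𝒰 (mem_inf_of_left (mem_principal_self W))
  have hA : ∀ A : Finset X, ∀ᶠ p in (𝒰 : Filter (X × X)), p.1 ∉ A := fun A =>
    h𝒰 (mem_inf_of_right (mem_inf_of_left (preimage_mem_comap A.finite_toSet.compl_mem_cofinite)))
  have hB : ∀ B : Finset X, ∀ᶠ p in (𝒰 : Filter (X × X)), p.2 ∉ B := fun B =>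
    h𝒰 (mem_inf_of_right (mem_inf_of_right (preimage_mem_comap B.finite_toSet.compl_mem_cofinite)))
  obtain ⟨q, -, hq⟩ := isCompact_univ.ultrafilter_le_nhds 𝒰 (by simp)
  have hq1 : Tendsto Prod.fst (𝒰 : Filter (X × X)) (𝓝 q.1) :=
    (continuous_fst.tendsto q).mono_left hq
  have hq2 : Tendsto Prod.snd (𝒰 : Filter (X × X)) (𝓝 q.2) :=
    (continuous_snd.tendsto q).mono_left hq
  have hsep : ∀ x y : X, x ≠ y → ∃ U : Set X, IsOpen U ∧ x ∈ U ∧ ∃ U' : Set X, IsOpen U' ∧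
      y ∈ U' ∧ Disjoint U U' := fun x y h => by
    obtain ⟨U, U', h1, h2, h3, h4, h5⟩ := t2_separation h
    exact ⟨U, h1, h3, U', h2, h4, h5⟩
  -- Each step picks a measure, a support point and an open box around it. The sides stay away from
  -- the coordinates of `q`, which leaves room for later boxes with disjoint sides; each new first
  -- side misses the first coordinates of all earlier supports.
  obtain ⟨t, ht1, ht2⟩ := exists_seq_of_forall_finset_exists
    (α := ℕ × (X × X) × (Set X × Set X))
    (fun t => t.2.1 ∈ (m t.1).support ∧
      (IsOpen t.2.2.1 ∧ t.2.1.1 ∈ t.2.2.1 ∧ t.2.2.1ᶜ ∈ 𝓝 q.1) ∧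
      (IsOpen t.2.2.2 ∧ t.2.1.2 ∈ t.2.2.2 ∧ t.2.2.2ᶜ ∈ 𝓝 q.2))
    (fun t u => Disjoint t.2.2.1 u.2.2.1 ∧ Disjoint t.2.2.2 u.2.2.2 ∧
      ∀ p ∈ (m t.1).support, p.1 ∉ u.2.2.1) (by
    intro s hs
    let past : Finset X := insert q.1 (s.biUnion fun t => (m t.1).support.image Prod.fst)
    have e1 : ∀ᶠ p in (𝒰 : Filter (X × X)), ∀ t ∈ s, p.1 ∈ interior t.2.2.1ᶜ :=
      (Finset.eventually_all s).2 fun t ht => hq1 (interior_mem_nhds.2 (hs t ht).2.1.2.2)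
    have e2 : ∀ᶠ p in (𝒰 : Filter (X × X)), ∀ t ∈ s, p.2 ∈ interior t.2.2.2ᶜ :=
      (Finset.eventually_all s).2 fun t ht => hq2 (interior_mem_nhds.2 (hs t ht).2.2.2.2)
    obtain ⟨p, ⟨n, hp⟩, hp1, hp2, hp3, hp4⟩ :=
      (hW.and ((hA past).and ((hB {q.2}).and (e1.and e2)))).exists
    obtain ⟨U, hU1, hU2, U', hU3, hU4, hU5⟩ := hsep p.1 q.1
      (fun h => hp1 (by rw [h]; exact Finset.mem_insert_self _ _))
    obtain ⟨V, hV1, hV2, V', hV3, hV4, hV5⟩ := hsep p.2 q.2 (fun h => hp2 (by simp [h]))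
    refine ⟨(n, p, U ∩ ((past : Set X)ᶜ ∩ ⋂ t ∈ s, interior t.2.2.1ᶜ),
      V ∩ ⋂ t ∈ s, interior t.2.2.2ᶜ),
      ⟨hp, ⟨?_, ⟨hU2, hp1, mem_iInter₂.2 hp3⟩, ?_⟩, ?_, ⟨hV2, mem_iInter₂.2 hp4⟩, ?_⟩, ?_⟩
    · exact hU1.inter (past.finite_toSet.isClosed.isOpen_compl.inter
        (isOpen_biInter_finset fun _ _ => isOpen_interior))
    · exact mem_of_superset (hU3.mem_nhds hU4) fun x hx h =>
        Set.disjoint_left.1 hU5 h.1 hx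
    · exact hV1.inter (isOpen_biInter_finset fun _ _ => isOpen_interior)
    · exact mem_of_superset (hV3.mem_nhds hV4) fun x hx h =>
        Set.disjoint_left.1 hV5 h.1 hx
    · intro t ht
      refine ⟨Set.disjoint_left.2 fun x hx h => ?_, Set.disjoint_left.2 fun x hx h => ?_,
        fun r hr h => ?_⟩
      · exact interior_subset (mem_iInter₂.1 h.2.2 t ht) hx
      · exact interior_subset (mem_iInter₂.1 h.2 t ht) hx
      · exact h.2.1 (Finset.mem_coe.2 (Finset.mem_insert_of_mem
          (Finset.mem_biUnion.2 ⟨t, ht, Finset.mem_image_of_mem _ hr⟩))))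
  have hU : ∀ i j, i ≠ j → Disjoint (t i).2.2.1 (t j).2.2.1 := fun i j hij => by
    rcases lt_or_gt_of_ne hij with h | h
    · exact (ht2 i j h).1
    · exact (ht2 j i h).1.symm
  have hV : ∀ i j, i ≠ j → Disjoint (t i).2.2.2 (t j).2.2.2 := fun i j hij => by
    rcases lt_or_gt_of_ne hij with h | h
    · exact (ht2 i j h).2.1
    · exact (ht2 j i h).2.1.symm
  choose f hf1 _ hf3 hf4 using fun k => exists_continuous_bump
    ((m (t k).1).support.image Prod.fst) (ht1 k).2.1.1 (ht1 k).2.1.2.1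
  choose h hh1 _ hh3 hh4 using fun k => exists_continuous_bump
    ((m (t k).1).support.image Prod.snd) (ht1 k).2.2.1 (ht1 k).2.2.2.1
  have hfdisj : ∀ i j, i ≠ j → ∀ x, f i x * f j x = 0 := by
    intro i j hij x
    by_cases hx : x ∈ (t i).2.2.1
    · rw [hf4 j x (Set.disjoint_left.1 (hU i j hij) hx), mul_zero]
    · rw [hf4 i x hx, zero_mul]
  have hhdisj : ∀ i j, i ≠ j → ∀ x, h i x * h j x = 0 := by
    intro i j hij x
    by_cases hx : x ∈ (t i).2.2.2
    · rw [hh4 j x (Set.disjoint_left.1 (hV i j hij) hx), mul_zero]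
    · rw [hh4 i x hx, zero_mul]
  have hdiag : ∀ k, fpair (m (t k).1) (fun p => f k p.1 * h k p.2) ≠ 0 := by
    intro k
    rw [fpair, Finset.sum_eq_single_of_mem _ (ht1 k).1, hf1, hh1, mul_one, mul_one]
    · exact Finsupp.mem_support_iff.1 (ht1 k).1
    · intro p hp hne
      by_cases h1 : p.1 = (t k).2.1.1
      · have h2 : p.2 ≠ (t k).2.1.2 := fun h2 => hne (Prod.ext h1 h2)
        rw [hh3 k p.2 (Finset.mem_image_of_mem _ hp) h2, mul_zero, mul_zero]
      · rw [hf3 k p.1 (Finset.mem_image_of_mem _ hp) h1, zero_mul, mul_zero]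
  -- The right-hand side `k` makes the integrals of the sum of `c j * f j x * h j y` unbounded.
  obtain ⟨c, hc⟩ := exists_triangular_solution
    (fun k j => fpair (m (t k).1) fun p => f j p.1 * h j p.2) hdiag (fun k => k)
  -- With one variable fixed, only one term of the series survives; joint continuity is not claimed.
  have hcont1 : ∀ x, Continuous fun y => ∑' j, c j * f j x * h j y := by
    intro x
    obtain ⟨k, hk⟩ := hasSum_mul_of_disjoint (f := fun j x => f j x) hfdisj x
    have : (fun y => ∑' j, c j * f j x * h j y) = fun y => c k * h k y * f k x := by
      ext y
      rw [← (hk fun j => c j * h j y).tsum_eq]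
      exact tsum_congr fun j => by ring
    rw [this]; fun_prop
  have hcont2 : ∀ y, Continuous fun x => ∑' j, c j * f j x * h j y := by
    intro y
    obtain ⟨k, hk⟩ := hasSum_mul_of_disjoint (f := fun j x => h j x) hhdisj y
    simp_rw [fun x => (hk fun j => c j * f j x).tsum_eq]
    fun_prop
  obtain ⟨C, hC⟩ := hm (curryCp (fun x y => ∑' j, c j * f j x * h j y) hcont1 hcont2)
  have hval : ∀ k, fpair (m (t k).1)
      (uncurryCp (curryCp (fun x y => ∑' j, c j * f j x * h j y) hcont1 hcont2)) = k := by
    intro k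
    have h1 : ∀ p ∈ (m (t k).1).support,
        uncurryCp (curryCp (fun x y => ∑' j, c j * f j x * h j y) hcont1 hcont2) p =
          ∑ j ∈ Finset.range (k + 1), c j * (f j p.1 * h j p.2) := by
      intro p hp
      rw [uncurryCp_curryCp, tsum_eq_sum (s := Finset.range (k + 1))]
      · exact Finset.sum_congr rfl fun j _ => by ring
      · intro j hj
        rw [Finset.mem_range, not_lt] at hj
        rw [hf4 j p.1 ((ht2 k j hj).2.2 p hp), mul_zero, zero_mul]
    rw [fpair_congr _ h1, ← hc k]
    simp only [fpair, Finset.mul_sum]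
    rw [Finset.sum_comm]
    exact Finset.sum_congr rfl fun j _ => Finset.sum_congr rfl fun x _ => by ring
  obtain ⟨k, hk⟩ := exists_nat_gt C
  have := hC (t k).1
  rw [hval, Nat.abs_cast] at this
  linarith

end Matching

/-! ### Exchange of coordinates and restriction to a fibre -/

section Swap

variable {X : Type*}

/-- The image of a finitely supported measure under the exchange of coordinates. -/
noncomputable def swapMeasure (m : X × X →₀ ℝ) : X × X →₀ ℝ :=
  Finsupp.equivMapDomain (Equiv.prodComm X X) m

theorem swapMeasure_apply (m : X × X →₀ ℝ) (p : X × X) : swapMeasure m p = m p.swap := rfl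

theorem mem_support_swapMeasure {m : X × X →₀ ℝ} {p : X × X} :
    p ∈ (swapMeasure m).support ↔ p.swap ∈ m.support := by
  simp [swapMeasure_apply]

theorem fpair_swapMeasure (m : X × X →₀ ℝ) (f : X × X → ℝ) :
    fpair (swapMeasure m) f = fpair m fun p => f p.swap := by
  refine Finset.sum_nbij' Prod.swap Prod.swap ?_ ?_ ?_ ?_ ?_ <;>
    simp [swapMeasure_apply]

theorem fvar_swapMeasure (m : X × X →₀ ℝ) (s : Set (X × X)) :
    fvar (swapMeasure m) s = fvar m (Prod.swap ⁻¹' s) := by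
  classical
  refine Finset.sum_nbij' Prod.swap Prod.swap ?_ ?_ ?_ ?_ ?_ <;>
    simp [swapMeasure_apply, Set.indicator_apply]

/-- The part of the fibre of `m` over `a` which lies off `B`. -/
noncomputable def fibreMeasure (m : X × X →₀ ℝ) (a : X) (B : Finset X) : X →₀ ℝ :=
  open Classical in
  (m.comapDomain (Prod.mk a) (Prod.mk_right_injective a).injOn).filter (· ∉ B)

theorem fibreMeasure_of_mem (m : X × X →₀ ℝ) (a : X) {B : Finset X} {y : X} (hy : y ∈ B) :
    fibreMeasure m a B y = 0 := by
  classical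
  exact Finsupp.filter_apply_neg _ _ (by simpa using hy)

theorem fibreMeasure_of_notMem (m : X × X →₀ ℝ) (a : X) {B : Finset X} {y : X} (hy : y ∉ B) :
    fibreMeasure m a B y = m (a, y) := by
  classical
  exact Finsupp.filter_apply_pos _ _ hy

theorem support_fibreMeasure_subset [DecidableEq X] (m : X × X →₀ ℝ) (a : X) (B : Finset X) :
    (fibreMeasure m a B).support ⊆ m.support.image Prod.snd := by
  intro y hy
  rw [Finsupp.mem_support_iff] at hy
  by_cases hyB : y ∈ B
  · exact absurd (fibreMeasure_of_mem m a hyB) hy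
  · rw [fibreMeasure_of_notMem m a hyB] at hy
    exact Finset.mem_image.2 ⟨(a, y), Finsupp.mem_support_iff.2 hy, rfl⟩

theorem support_subset_product [DecidableEq X] (m : X × X →₀ ℝ) (a : X) :
    m.support ⊆ (insert a (m.support.image Prod.fst)) ×ˢ m.support.image Prod.snd := by
  intro p hp
  rw [Finset.mem_product]
  exact ⟨Finset.mem_insert_of_mem (Finset.mem_image_of_mem _ hp), Finset.mem_image_of_mem _ hp⟩

/-- A support point off the fibre over `a` has first coordinate in `A`, where `u` vanishes, or
second coordinate in `B`, where `h` does. So product functions test the fibre alone. -/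
theorem fpair_fibreMeasure {m : X × X →₀ ℝ} {A B : Finset X}
    (hm : ∀ p ∈ m.support, p.1 ∈ A ∨ p.2 ∈ B) {a : X} {u h : X → ℝ} (hua : u a = 1)
    (hu : ∀ x ∈ A, x ≠ a → u x = 0) (hh : ∀ y ∈ B, h y = 0) :
    fpair (fibreMeasure m a B) h = fpair m fun p => u p.1 * h p.2 := by
  classical
  rw [fpair_eq_sum _ (support_fibreMeasure_subset m a B),
    fpair_eq_sum _ (support_subset_product m a), Finset.sum_product,
    Finset.sum_eq_single_of_mem a (Finset.mem_insert_self _ _)]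
  · refine Finset.sum_congr rfl fun y _ => ?_
    by_cases hy : y ∈ B
    · simp [hh y hy]
    · rw [fibreMeasure_of_notMem m a hy, hua, one_mul]
  · intro x _ hx
    refine Finset.sum_eq_zero fun y _ => ?_
    by_cases hp : (x, y) ∈ m.support
    · rcases hm _ hp with h1 | h1
      · simp [hu x h1 hx]
      · simp [hh y h1]
    · simp [Finsupp.notMem_support_iff.1 hp]

theorem fvar_fibreMeasure (m : X × X →₀ ℝ) (a : X) (B : Finset X) :
    fvar (fibreMeasure m a B) univ = fvar m {p | p.1 = a ∧ p.2 ∉ B} := by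
  classical
  rw [fvar_eq_sum _ (support_fibreMeasure_subset m a B),
    fvar_eq_sum _ (support_subset_product m a), Finset.sum_product,
    Finset.sum_eq_single_of_mem a (Finset.mem_insert_self _ _)]
  · refine Finset.sum_congr rfl fun y _ => ?_
    by_cases hy : y ∈ B
    · simp [fibreMeasure_of_mem m a hy, hy]
    · simp [fibreMeasure_of_notMem m a hy, hy]
  · intro x _ hx
    exact Finset.sum_eq_zero fun y _ => by simp [hx]

end Swap

/-! ### Norm estimates on the fibres and non-surjectivity -/

section Fibres

variable {X : Type*} [TopologicalSpace X] [CompactSpace X] [T2Space X]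

theorem tendsto_fvar_fibre (hX : ¬ ContainsComplementedCopy (Cp X ℝ) c0p)
    {m : ℕ → X × X →₀ ℝ} {A B : Finset X}
    (hAB : ∀ n, ∀ p ∈ (m n).support, p.1 ∈ A ∨ p.2 ∈ B)
    (hm : ∀ u h : C(X, ℝ), Tendsto (fun n => fpair (m n) fun p => u p.1 * h p.2) atTop (𝓝 0))
    (a : X) : Tendsto (fun n => fvar (m n) {p | p.1 = a ∧ p.2 ∉ B}) atTop (𝓝 0) := by
  obtain ⟨u, hu1, -, hu2, -⟩ := exists_continuous_bump A isOpen_univ (mem_univ a)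
  simp_rw [← fvar_fibreMeasure]
  refine tendsto_fvar_of_tendsto_fpair_of_vanishing hX B
    (fun n x hx => fibreMeasure_of_mem _ _ hx) fun h hh => ?_
  simp_rw [fun n => fpair_fibreMeasure (hAB n) hu1 hu2 hh]
  exact hm u h

/-- The support splits into fibres over `A` off `B`, fibres over `B` off `A` (by exchange of
coordinates) and the finite corner `A ×ˢ B`. At a corner point a product of bumps recovers the mass
up to an error carried by two fibres already known to be small. -/
theorem tendsto_fvar_of_fibres (hX : ¬ ContainsComplementedCopy (Cp X ℝ) c0p)
    {m : ℕ → X × X →₀ ℝ} {A B : Finset X}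
    (hAB : ∀ n, ∀ p ∈ (m n).support, p.1 ∈ A ∨ p.2 ∈ B)
    (hm : ∀ u h : C(X, ℝ), Tendsto (fun n => fpair (m n) fun p => u p.1 * h p.2) atTop (𝓝 0)) :
    Tendsto (fun n => fvar (m n) univ) atTop (𝓝 0) := by
  classical
  have hleft := tendsto_fvar_fibre hX hAB hm
  have hright : ∀ b, Tendsto (fun n => fvar (m n) {p | p.2 = b ∧ p.1 ∉ A}) atTop (𝓝 0) := by
    intro b
    have h1 := tendsto_fvar_fibre hX (m := fun n => swapMeasure (m n)) (A := B) (B := A)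
      (fun n p hp => (hAB n _ (mem_support_swapMeasure.1 hp)).symm)
      (fun u h => by
        simp_rw [fpair_swapMeasure]
        refine (hm h u).congr fun n => ?_
        congr 1
        ext p
        exact mul_comm _ _) b
    simp_rw [fvar_swapMeasure] at h1
    exact h1
  have hpoint : ∀ a ∈ A, ∀ b ∈ B, Tendsto (fun n => m n (a, b)) atTop (𝓝 0) := by
    intro a _ b _
    obtain ⟨u, hu1, hu0, hu2, -⟩ := exists_continuous_bump A isOpen_univ (mem_univ a)
    obtain ⟨v, hv1, hv0, hv2, -⟩ := exists_continuous_bump B isOpen_univ (mem_univ b)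
    have hbound : ∀ n, |m n (a, b)| ≤ |fpair (m n) fun p => u p.1 * v p.2| +
        (fvar (m n) {p | p.1 = a ∧ p.2 ∉ B} + fvar (m n) {p | p.2 = b ∧ p.1 ∉ A}) := by
      intro n
      let r : X × X → ℝ := fun p => if p = (a, b) then 0 else u p.1 * v p.2
      have h1 : fpair (m n) (fun p => u p.1 * v p.2) = m n (a, b) + fpair (m n) r := by
        have h2 : (fun p : X × X => u p.1 * v p.2) = (Pi.single (a, b) 1 : X × X → ℝ) + r := by
          ext p
          by_cases hp : p = (a, b)
          · subst hp; simp [r, hu1, hv1]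
          · simp [r, hp]
        rw [h2, fpair_add_right]
        congr 1
        rw [fpair_eq_sum (m n) (Finset.subset_insert (a, b) _),
          Finset.sum_eq_single_of_mem _ (Finset.mem_insert_self _ _)]
        · simp
        · intro p _ hp
          simp [hp]
      have h3 : |fpair (m n) r| ≤
          1 * fvar (m n) ({p | p.1 = a ∧ p.2 ∉ B} ∪ {p | p.2 = b ∧ p.1 ∉ A}) := by
        refine abs_fpair_le _ _ _ _ (fun p _ => ?_) fun p hp hps => ?_
        · simp only [r]
          split_ifs
          · simp
          · rw [abs_mul]
            exact mul_le_one₀ (hu0 _) (abs_nonneg _) (hv0 _)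
        · simp only [r]
          split_ifs with hpab
          · rfl
          simp only [mem_union, mem_ofPred_eq, not_or, not_and, not_not] at hps
          by_cases ha : p.1 = a
          · have hb : p.2 ≠ b := fun hb => hpab (Prod.ext ha hb)
            rw [hv2 p.2 (hps.1 ha) hb, mul_zero]
          · by_cases hA : p.1 ∈ A
            · rw [hu2 p.1 hA ha, zero_mul]
            · have hB := (hAB n p hp).resolve_left hA
              have hb : p.2 ≠ b := fun hb => hA (hps.2 hb)
              rw [hv2 p.2 hB hb, mul_zero]
      rw [one_mul] at h3
      have h4 := h3.trans (fvar_union_le _ _ _)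
      have h5 : m n (a, b) = (fpair (m n) fun p => u p.1 * v p.2) - fpair (m n) r := by
        rw [h1]; ring
      rw [h5]
      exact (abs_sub _ _).trans (by linarith)
    refine squeeze_zero_norm hbound ?_
    simpa using (hm u v).abs.add ((hleft a).add (hright b))
  have hcorner : Tendsto (fun n => fvar (m n) ((A ×ˢ B : Finset (X × X)) : Set (X × X)))
      atTop (𝓝 0) := by
    simp only [fvar_finset]
    rw [show (0 : ℝ) = ∑ p ∈ A ×ˢ B, |(0 : ℝ)| by simp]
    refine tendsto_finsetSum _ fun p hp => ?_
    rw [Finset.mem_product] at hp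
    exact (hpoint p.1 hp.1 p.2 hp.2).abs
  have hsum : Tendsto (fun n => ∑ a ∈ A, fvar (m n) {p | p.1 = a ∧ p.2 ∉ B} +
      ∑ b ∈ B, fvar (m n) {p | p.2 = b ∧ p.1 ∉ A} +
      fvar (m n) ((A ×ˢ B : Finset (X × X)) : Set (X × X))) atTop (𝓝 0) := by
    have h1 := tendsto_finsetSum A fun a _ => hleft a
    have h2 := tendsto_finsetSum B fun b _ => hright b
    simpa using (h1.add h2).add hcorner
  refine squeeze_zero (fun n => fvar_nonneg _ _) (fun n => ?_) hsum
  have hcover : fvar (m n) univ ≤ fvar (m n) (((⋃ a ∈ A, {p | p.1 = a ∧ p.2 ∉ B}) ∪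
      ⋃ b ∈ B, {p | p.2 = b ∧ p.1 ∉ A}) ∪ ((A ×ˢ B : Finset (X × X)) : Set (X × X))) := by
    refine fvar_mono _ fun p hp _ => ?_
    by_cases hA : p.1 ∈ A <;> by_cases hB : p.2 ∈ B
    · exact Or.inr (Finset.mem_coe.2 (Finset.mem_product.2 ⟨hA, hB⟩))
    · exact Or.inl (Or.inl (mem_iUnion₂.2 ⟨p.1, hA, rfl, hB⟩))
    · exact Or.inl (Or.inr (mem_iUnion₂.2 ⟨p.2, hB, rfl, hA⟩))
    · exact absurd (hAB n p hp) (by simp [hA, hB])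
  exact hcover.trans ((fvar_union_le _ _ _).trans (add_le_add_left ((fvar_union_le _ _ _).trans
    (add_le_add (fvar_biUnion_le _ _ _) (fvar_biUnion_le _ _ _))) _))

/-- Norm estimates for pointwise null sequences of functionals on `C_p(X, C_p(X))`. -/
theorem exists_bound_of_separatelyContinuous (hX : ¬ ContainsComplementedCopy (Cp X ℝ) c0p)
    {m : ℕ → X × X →₀ ℝ}
    (hm : ∀ g : Cp X (Cp X ℝ), Tendsto (fun n => fpair (m n) (uncurryCp g)) atTop (𝓝 0)) :
    ∃ ε : ℕ → ℝ, (∀ n, 0 ≤ ε n) ∧ Tendsto ε atTop (𝓝 0) ∧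
      ∀ g : Cp X (Cp X ℝ), ∃ C, ∀ n, |fpair (m n) (uncurryCp g)| ≤ C * ε n := by
  obtain ⟨A, B, hAB⟩ := exists_finite_fibres (m := m) fun g => by
    obtain ⟨C, hC⟩ := (Metric.isBounded_range_of_tendsto _ (hm g)).exists_norm_le
    exact ⟨C, fun n => hC _ ⟨n, rfl⟩⟩
  refine ⟨fun n => fvar (m n) univ, fun n => fvar_nonneg _ _,
    tendsto_fvar_of_fibres hX hAB fun u h => ?_, fun g => ?_⟩
  · exact hm (curryCp (fun x y => u x * h y) (fun x => by fun_prop) fun y => by fun_prop)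
  -- A separately continuous function may be unbounded on X × X, but it is bounded on each of the
  -- finitely many compact fibres.
  · have hbdd : Bornology.IsBounded ((⋃ a ∈ A, range fun y => uncurryCp g (a, y)) ∪
        ⋃ b ∈ B, range fun x => uncurryCp g (x, b)) :=
      ((Bornology.isBounded_biUnion_finset A).2 fun a _ =>
        (isCompact_range (continuous_uncurryCp_right g a)).isBounded).union
      ((Bornology.isBounded_biUnion_finset B).2 fun b _ =>
        (isCompact_range (continuous_uncurryCp_left g b)).isBounded)
    obtain ⟨C, hC⟩ := hbdd.exists_norm_le
    refine ⟨C, fun n => abs_fpair_le _ _ _ _ (fun p hp => hC _ ?_)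
      fun p _ h => absurd (mem_univ p) h⟩
    rcases hAB n p hp with h | h
    · exact Or.inl (mem_iUnion₂.2 ⟨p.1, h, p.2, rfl⟩)
    · exact Or.inr (mem_iUnion₂.2 ⟨p.2, h, p.1, rfl⟩)

/-- A weak-star null sequence of functionals on `C(X)` which is not norm null obstructs continuous
linear surjections from `C_p(X, C_p(X))` onto `C_p(X, C(X)_w)`. -/
theorem not_surjective_of_null_functionals [Nonempty X]
    (hX : ¬ ContainsComplementedCopy (Cp X ℝ) c0p) {μ : ℕ → StrongDual ℝ C(X, ℝ)}
    (hμ : ∀ f, Tendsto (fun n => μ n f) atTop (𝓝 0)) (hnorm : ∀ n, 1 ≤ ‖μ n‖)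
    (T : Cp X (Cp X ℝ) →L[ℝ] Cp X (WeakSpace ℝ C(X, ℝ))) : ¬ Function.Surjective T := by
  intro hT
  obtain ⟨x₀⟩ := ‹Nonempty X›
  let ψ : ℕ → Cp X (WeakSpace ℝ C(X, ℝ)) →L[ℝ] ℝ := fun n =>
    { toFun := fun g => μ n ((toWeakSpace ℝ C(X, ℝ)).symm (g.1 x₀))
      map_add' := fun g h => (μ n).map_add _ _
      map_smul' := fun c g => (μ n).map_smul _ _
      cont := by
        have h1 : Continuous fun w : WeakSpace ℝ C(X, ℝ) =>
            μ n ((toWeakSpace ℝ C(X, ℝ)).symm w) :=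
          WeakBilin.eval_continuous (topDualPairing ℝ C(X, ℝ)).flip (μ n)
        exact h1.comp ((continuous_apply x₀).comp continuous_subtype_val) }
  choose m hm using fun n => exists_fpair_eq ((ψ n).comp T)
  have hm' : ∀ n g, fpair (m n) (uncurryCp g) =
      μ n ((toWeakSpace ℝ C(X, ℝ)).symm ((T g).1 x₀)) := fun n g => (hm n g).symm
  obtain ⟨ε, hε0, hε, hbound⟩ := exists_bound_of_separatelyContinuous hX (m := m) (by
    intro g
    simp_rw [hm']
    exact hμ _)
  -- The extra null term makes `δ n` positive, so that `μ n` can be divided by it.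
  let δ : ℕ → ℝ := fun n => ε n + 1 / ((n : ℝ) + 1)
  have hδ : Tendsto δ atTop (𝓝 0) := by
    have := hε.add (tendsto_one_div_add_atTop_nhds_zero_nat (𝕜 := ℝ))
    rwa [add_zero] at this
  have hδ0 : ∀ n, 0 < δ n := fun n => add_pos_of_nonneg_of_pos (hε0 n) (by positivity)
  obtain ⟨C, hC⟩ := banach_steinhaus (g := fun n => (δ n)⁻¹ • μ n) (by
    intro f
    obtain ⟨g, hg⟩ := hT ⟨fun _ => toWeakSpace ℝ C(X, ℝ) f, continuous_const⟩
    obtain ⟨C, hC⟩ := hbound g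
    refine ⟨|C|, fun n => ?_⟩
    have h1 := hC n
    rw [hm', hg] at h1
    simp only [LinearEquiv.symm_apply_apply] at h1
    rw [_root_.smul_apply, smul_eq_mul, Real.norm_eq_abs, abs_mul,
      abs_of_pos (inv_pos.2 (hδ0 n)), inv_mul_le_iff₀ (hδ0 n)]
    have h2 : (0 : ℝ) ≤ 1 / ((n : ℝ) + 1) := by positivity
    calc |μ n f| ≤ C * ε n := h1
      _ ≤ |C| * ε n := mul_le_mul_of_nonneg_right (le_abs_self C) (hε0 n)
      _ ≤ |C| * δ n := mul_le_mul_of_nonneg_left (by simp only [δ]; linarith) (abs_nonneg _)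
      _ = δ n * |C| := mul_comm _ _)
  have h1 : ∀ n, 1 ≤ C * δ n := by
    intro n
    have h2 := hC n
    rw [norm_smul, norm_inv, Real.norm_eq_abs, abs_of_pos (hδ0 n), inv_mul_le_iff₀ (hδ0 n)] at h2
    linarith [hnorm n, mul_comm C (δ n)]
  have h3 : (1 : ℝ) ≤ C * 0 := ge_of_tendsto' (hδ.const_mul C) h1
  norm_num at h3

end Fibres

/-! ### Bessel's inequality and Rademacher signs -/

/-- Bessel's inequality for a finite orthogonal family of functions on a finite set. -/
theorem sum_sq_sum_mul_le {S ι : Type*} [Fintype S] [DecidableEq ι] (t : Finset ι)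
    (r : ι → S → ℝ)
    (hr : ∀ i ∈ t, ∀ j ∈ t, ∑ s, r i s * r j s = if i = j then (Fintype.card S : ℝ) else 0)
    (F : S → ℝ) :
    ∑ i ∈ t, (∑ s, r i s * F s) ^ 2 ≤ Fintype.card S * ∑ s, F s ^ 2 := by
  rcases isEmpty_or_nonempty S with hS | hS
  · simp
  set c : ℝ := (Fintype.card S : ℝ) with hcdef
  have hc : 0 < c := by rw [hcdef]; exact_mod_cast Fintype.card_pos
  set d : ι → ℝ := fun i => ∑ s, r i s * F s with hd
  -- The residual of the orthogonal projection, scaled by `c`; expanding its square gives the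
  -- inequality.
  have h1 : 0 ≤ ∑ s, (c * F s - ∑ i ∈ t, d i * r i s) ^ 2 := Finset.sum_nonneg fun _ _ => sq_nonneg _
  have h2 : ∑ s, F s * ∑ i ∈ t, d i * r i s = ∑ i ∈ t, d i ^ 2 := by
    simp_rw [Finset.mul_sum]
    rw [Finset.sum_comm]
    refine Finset.sum_congr rfl fun i _ => ?_
    rw [sq]
    conv_rhs => rw [hd]
    simp only [Finset.mul_sum]
    refine Finset.sum_congr rfl fun s _ => ?_
    simp only [hd]
    ring
  have h3 : ∑ s, (∑ i ∈ t, d i * r i s) ^ 2 = c * ∑ i ∈ t, d i ^ 2 := by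
    calc ∑ s, (∑ i ∈ t, d i * r i s) ^ 2
        = ∑ s, ∑ i ∈ t, ∑ j ∈ t, (d i * d j) * (r i s * r j s) := by
          refine Finset.sum_congr rfl fun s _ => ?_
          rw [sq, Finset.sum_mul_sum]
          exact Finset.sum_congr rfl fun i _ => Finset.sum_congr rfl fun j _ => by ring
      _ = ∑ i ∈ t, ∑ j ∈ t, (d i * d j) * ∑ s, r i s * r j s := by
          rw [Finset.sum_comm]
          refine Finset.sum_congr rfl fun i _ => ?_
          rw [Finset.sum_comm]
          exact Finset.sum_congr rfl fun j _ => (Finset.mul_sum _ _ _).symm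
      _ = ∑ i ∈ t, ∑ j ∈ t, (d i * d j) * if i = j then c else 0 :=
          Finset.sum_congr rfl fun i hi => Finset.sum_congr rfl fun j hj => by rw [hr i hi j hj]
      _ = c * ∑ i ∈ t, d i ^ 2 := by
          rw [Finset.mul_sum]
          refine Finset.sum_congr rfl fun i hi => ?_
          simp only [mul_ite, mul_zero, Finset.sum_ite_eq, hi, if_true]
          ring
  have h4 : ∑ s, (c * F s - ∑ i ∈ t, d i * r i s) ^ 2 =
      c * (c * ∑ s, F s ^ 2 - ∑ i ∈ t, d i ^ 2) := by
    calc _ = ∑ s, (c ^ 2 * F s ^ 2 - 2 * c * (F s * ∑ i ∈ t, d i * r i s) +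
          (∑ i ∈ t, d i * r i s) ^ 2) := Finset.sum_congr rfl fun s _ => by ring
      _ = _ := by
          rw [Finset.sum_add_distrib, Finset.sum_sub_distrib, ← Finset.mul_sum, ← Finset.mul_sum,
            h2, h3]
          ring
  rw [h4] at h1
  linarith [nonneg_of_mul_nonneg_right h1 hc]

/-- The Rademacher sign of a Boolean. -/
def boolSign (b : Bool) : ℝ := if b then 1 else -1

theorem boolSign_mul_self (b : Bool) : boolSign b * boolSign b = 1 := by
  cases b <;> norm_num [boolSign]

theorem boolSign_not (b : Bool) : boolSign (!b) = -boolSign b := by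
  cases b <;> norm_num [boolSign]

theorem abs_boolSign (b : Bool) : |boolSign b| = 1 := by
  cases b <;> norm_num [boolSign]

/-- For distinct indices, flipping the `i`-th bit permutes the sign vectors and negates every
summand. -/
theorem sum_boolSign_mul {N : ℕ} (i j : Fin N) :
    ∑ s : Fin N → Bool, boolSign (s i) * boolSign (s j) =
      if i = j then (Fintype.card (Fin N → Bool) : ℝ) else 0 := by
  classical
  split_ifs with h
  · subst h
    simp [boolSign_mul_self]
  · let flip : (Fin N → Bool) ≃ (Fin N → Bool) :=
      { toFun := fun s => Function.update s i (!s i)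
        invFun := fun s => Function.update s i (!s i)
        left_inv := fun s => by simp
        right_inv := fun s => by simp }
    have h1 := Equiv.sum_comp flip fun s => boolSign (s i) * boolSign (s j)
    have h2 : ∀ s, boolSign (flip s i) * boolSign (flip s j) =
        -(boolSign (s i) * boolSign (s j)) := fun s => by
      simp [flip, Function.update_of_ne (Ne.symm h), boolSign_not]
    simp_rw [h2, Finset.sum_neg_distrib] at h1
    linarith

/-! ### Weak-star null functionals on non-scattered spaces -/

section Cantor

variable {X : Type*} [TopologicalSpace X] [CompactSpace X] [T2Space X]

/-- A non-scattered compact space contains a Cantor family of points on which the coordinates are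
induced by continuous functions. -/
theorem exists_cantor_family (hX : ¬ IsScatteredSpace X) :
    ∃ (x : (ℕ → Bool) → X) (h : ℕ → C(X, ℝ)),
      (∀ n y, |h n y| ≤ 1) ∧ ∀ n σ, h n (x σ) = boolSign (σ n) := by
  classical
  obtain ⟨P, hP, hPne⟩ : ∃ P : Set X, Perfect P ∧ P.Nonempty := by
    rw [IsScatteredSpace] at hX
    push Not at hX
    obtain ⟨A, hA, hiso⟩ := hX
    refine ⟨closure A, Preperfect.perfect_closure fun x hx => ?_, hA.closure⟩
    rw [accPt_iff_nhds]
    intro U hU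
    obtain ⟨V, hVU, hV, hxV⟩ := mem_nhds_iff.1 hU
    by_contra hno
    push Not at hno
    refine hiso x hx V hV (Set.eq_singleton_iff_unique_mem.2 ⟨⟨hxV, hx⟩, fun y hy => ?_⟩)
    exact hno y ⟨hVU hy.1, hy.2⟩
  let Q := {C : Set X // Perfect C ∧ C.Nonempty}
  have hsplit : ∀ C : Q, ∃ D : Bool → Q, (∀ b, (D b).1 ⊆ C.1) ∧ Disjoint (D true).1 (D false).1 := by
    rintro ⟨C, hC, hne⟩
    obtain ⟨C₀, C₁, ⟨h1, h2, h3⟩, ⟨h4, h5, h6⟩, h7⟩ := hC.splitting hne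
    exact ⟨fun b => if b then ⟨C₀, h1, h2⟩ else ⟨C₁, h4, h5⟩, fun b => by cases b <;> simp [h3, h6],
      by simpa using h7⟩
  choose D hD1 hD2 using hsplit
  -- The newest bit is the head of the list, as in `PiNat.res`; the bit `σ n` is thus decided by the
  -- head at level n + 1.
  let E : List Bool → Q := fun l => l.rec ⟨P, hP, hPne⟩ fun b _ C => D C b
  have hEcons : ∀ b l, E (b :: l) = D (E l) b := fun _ _ => rfl
  have hEdisj : ∀ l l' : List Bool, l.length = l'.length → l ≠ l' → Disjoint (E l).1 (E l').1 := by
    intro l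
    induction l with
    | nil =>
      intro l' hl hne
      exact absurd (List.length_eq_zero_iff.1 hl.symm).symm hne
    | cons b l ih =>
      rintro (_ | ⟨b', l'⟩) hl hne
      · simp at hl
      rw [hEcons, hEcons]
      by_cases hll : l = l'
      · subst hll
        have hb : b ≠ b' := fun h => hne (by rw [h])
        cases b <;> cases b' <;> first | exact absurd rfl hb | exact hD2 _ | exact (hD2 _).symm
      · exact (ih l' (by simpa using hl) hll).mono (hD1 _ _) (hD1 _ _)
  have hpt : ∀ σ : ℕ → Bool, (⋂ n, (E (PiNat.res σ n)).1).Nonempty := fun σ =>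
    IsCompact.nonempty_iInter_of_sequence_nonempty_isCompact_isClosed _
      (fun n => hD1 _ _) (fun n => (E _).2.2) (E (PiNat.res σ 0)).2.1.closed.isCompact
      fun n => (E _).2.1.closed
  choose x hx using hpt
  have hlev : ∀ n b, IsClosed (⋃ l ∈ {l : List Bool | l.length = n}, (E (b :: l)).1) := fun n b =>
    (List.finite_length_eq Bool n).isClosed_biUnion fun l _ => (E (b :: l)).2.1.closed
  have hmem : ∀ n σ, x σ ∈ ⋃ l ∈ {l : List Bool | l.length = n}, (E (σ n :: l)).1 := fun n σ =>
    mem_iUnion₂.2 ⟨PiNat.res σ n, PiNat.res_length σ n, mem_iInter.1 (hx σ) (n + 1)⟩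
  have hsep : ∀ n, ∃ h : C(X, ℝ), (∀ y, |h y| ≤ 1) ∧ ∀ σ, h (x σ) = boolSign (σ n) := by
    intro n
    obtain ⟨f, hf0, hf1, hf⟩ := exists_continuous_zero_one_of_isClosed (hlev n false) (hlev n true)
      (by
        refine Set.disjoint_left.2 fun y hy hy' => ?_
        obtain ⟨l, hl, hyl⟩ := mem_iUnion₂.1 hy
        obtain ⟨l', hl', hyl'⟩ := mem_iUnion₂.1 hy'
        refine Set.disjoint_left.1 (hEdisj (false :: l) (true :: l') ?_ (by simp)) hyl hyl'
        rw [List.length_cons, List.length_cons]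
        exact congrArg (· + 1) (hl.trans hl'.symm))
    refine ⟨⟨fun y => 2 * f y - 1, by fun_prop⟩, fun y => ?_, fun σ => ?_⟩
    · have := hf y
      rw [ContinuousMap.coe_mk, abs_le]
      constructor <;> linarith [this.1, this.2]
    · have hm := hmem n σ
      rw [ContinuousMap.coe_mk]
      cases hσ : σ n <;> rw [hσ] at hm
      · rw [hf0 hm]; norm_num [boolSign]
      · rw [hf1 hm]; norm_num [boolSign]
  choose h hh1 hh2 using hsep
  exact ⟨x, h, hh1, hh2⟩

/-- The average of a function against a sign over the branches that vanish from level `N` on. -/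
noncomputable def rademacherAverage (x : (ℕ → Bool) → X) (N n : ℕ) : StrongDual ℝ C(X, ℝ) :=
  (2 ^ N : ℝ)⁻¹ • ∑ s : Fin N → Bool,
    boolSign (if h : n < N then s ⟨n, h⟩ else false) •
      ContinuousMap.evalCLM ℝ (x fun i => if h : i < N then s ⟨i, h⟩ else false)

omit [CompactSpace X] [T2Space X] in
theorem rademacherAverage_apply (x : (ℕ → Bool) → X) (N n : ℕ) (f : C(X, ℝ)) :
    rademacherAverage x N n f = (2 ^ N : ℝ)⁻¹ * ∑ s : Fin N → Bool,
      boolSign (if h : n < N then s ⟨n, h⟩ else false) *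
        f (x fun i => if h : i < N then s ⟨i, h⟩ else false) := by
  simp [rademacherAverage]

omit [T2Space X] in
theorem norm_rademacherAverage_le (x : (ℕ → Bool) → X) (N n : ℕ) :
    ‖rademacherAverage x N n‖ ≤ 1 := by
  refine ContinuousLinearMap.opNorm_le_bound _ zero_le_one fun f => ?_
  rw [rademacherAverage_apply, norm_mul, norm_inv, norm_pow, Real.norm_two,
    inv_mul_le_iff₀ (by positivity)]
  refine (norm_sum_le _ _).trans ?_
  have : ∀ s ∈ (Finset.univ : Finset (Fin N → Bool)),
      ‖boolSign (if h : n < N then s ⟨n, h⟩ else false) *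
        f (x fun i => if h : i < N then s ⟨i, h⟩ else false)‖ ≤ ‖f‖ := fun s _ => by
    rw [norm_mul, Real.norm_eq_abs, abs_boolSign, one_mul]
    exact f.norm_coe_le_norm _
  refine (Finset.sum_le_card_nsmul _ _ _ this).trans ?_
  simp

omit [T2Space X] in
theorem sum_sq_rademacherAverage_le (x : (ℕ → Bool) → X) (f : C(X, ℝ)) {M N : ℕ} (hMN : M ≤ N) :
    ∑ n ∈ Finset.range M, rademacherAverage x N n f ^ 2 ≤ ‖f‖ ^ 2 := by
  classical
  have hcard : (Fintype.card (Fin N → Bool) : ℝ) = 2 ^ N := by simp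
  have h1 := sum_sq_sum_mul_le (S := Fin N → Bool) (Finset.range M)
    (fun n s => boolSign (if h : n < N then s ⟨n, h⟩ else false))
    (fun i hi j hj => by
      have hi' : i < N := (Finset.mem_range.1 hi).trans_le hMN
      have hj' : j < N := (Finset.mem_range.1 hj).trans_le hMN
      simp only [hi', hj', dif_pos]
      rw [sum_boolSign_mul]
      simp only [Fin.mk.injEq])
    (fun s => f (x fun i => if h : i < N then s ⟨i, h⟩ else false))
  have h2 : ∑ s : Fin N → Bool, f (x fun i => if h : i < N then s ⟨i, h⟩ else false) ^ 2 ≤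
      2 ^ N * ‖f‖ ^ 2 := by
    have : ∀ s ∈ (Finset.univ : Finset (Fin N → Bool)),
        f (x fun i => if h : i < N then s ⟨i, h⟩ else false) ^ 2 ≤ ‖f‖ ^ 2 := fun s _ => by
      rw [← sq_abs]
      exact pow_le_pow_left₀ (abs_nonneg _) (f.norm_coe_le_norm _) 2
    refine (Finset.sum_le_card_nsmul _ _ _ this).trans ?_
    simp
  simp_rw [rademacherAverage_apply, mul_pow]
  rw [← Finset.mul_sum, inv_pow, inv_mul_le_iff₀ (by positivity)]
  rw [hcard] at h1
  refine h1.trans ?_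
  rw [sq ((2 : ℝ) ^ N), mul_assoc]
  exact mul_le_mul_of_nonneg_left h2 (by positivity)

/-- On a non-scattered compact space there is a weak-star null sequence of functionals of norm at
least one. -/
theorem exists_null_functionals (hX : ¬ IsScatteredSpace X) :
    ∃ μ : ℕ → StrongDual ℝ C(X, ℝ),
      (∀ f, Tendsto (fun n => μ n f) atTop (𝓝 0)) ∧ ∀ n, 1 ≤ ‖μ n‖ := by
  obtain ⟨x, h, hh1, hh2⟩ := exists_cantor_family hX
  have hle : (hyperfilter ℕ : Filter ℕ) ≤ atTop := by
    rw [← Nat.cofinite_eq_atTop]; exact hyperfilter_le_cofinite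
  have hlim : ∀ n, ∃ μ : StrongDual ℝ C(X, ℝ), ∀ f,
      Tendsto (fun N => rademacherAverage x N n f) (hyperfilter ℕ) (𝓝 (μ f)) := by
    intro n
    obtain ⟨w, -, hw⟩ := (WeakDual.isCompact_closedBall (𝕜 := ℝ) (E := C(X, ℝ)) 0 1).ultrafilter_le_nhds
      ((hyperfilter ℕ).map fun N => StrongDual.toWeakDual (rademacherAverage x N n)) (by
        rw [le_principal_iff, Ultrafilter.coe_map, mem_map]
        refine univ_mem' fun N => ?_
        simpa using norm_rademacherAverage_le x N n)
    refine ⟨WeakDual.toStrongDual w, fun f => ?_⟩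
    exact ((WeakDual.eval_continuous f).tendsto w).comp hw
  choose μ hμ using hlim
  refine ⟨μ, fun f => ?_, fun n => ?_⟩
  -- Bessel's inequality, uniform in `N`, passes to the limit; square summability makes `μ n f`
  -- null.
  · have h1 : ∀ M, ∑ n ∈ Finset.range M, μ n f ^ 2 ≤ ‖f‖ ^ 2 := fun M =>
      le_of_tendsto (tendsto_finsetSum _ fun n _ => (hμ n f).pow 2)
        (Filter.Eventually.mono (hle (eventually_ge_atTop M)) fun N hN => sum_sq_rademacherAverage_le x f hN)
    have h2 : Summable fun n => μ n f ^ 2 :=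
      summable_of_sum_range_le (fun _ => sq_nonneg _) h1
    have h3 := h2.tendsto_atTop_zero
    have h4 : Tendsto (fun n => |μ n f|) atTop (𝓝 0) := by
      have := h3.sqrt
      simpa [Real.sqrt_sq_eq_abs] using this
    exact (tendsto_zero_iff_abs_tendsto_zero _).2 h4
  -- Every average gives exactly 1, even for `N ≤ n`, where the padding bit enters both factors.
  · have h1 : μ n (h n) = 1 := by
      refine tendsto_nhds_unique (hμ n (h n)) (tendsto_const_nhds.congr fun N => ?_)
      rw [rademacherAverage_apply]
      simp_rw [hh2, boolSign_mul_self]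
      simp
    have h2 : ‖h n‖ ≤ 1 := (ContinuousMap.norm_le _ zero_le_one).2 fun y => hh1 n y
    have h3 := (μ n).le_opNorm (h n)
    rw [h1, norm_one] at h3
    nlinarith [norm_nonneg (μ n)]

theorem not_surjective_of_not_isScatteredSpace (hs : ¬ IsScatteredSpace X)
    (hX : ¬ ContainsComplementedCopy (Cp X ℝ) c0p)
    (T : Cp X (Cp X ℝ) →L[ℝ] Cp X (WeakSpace ℝ C(X, ℝ))) : ¬ Function.Surjective T := by
  obtain ⟨μ, hμ, hnorm⟩ := exists_null_functionals hs
  have : Nonempty X := by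
    obtain ⟨x, -⟩ := exists_cantor_family hs
    exact ⟨x fun _ => false⟩
  exact not_surjective_of_null_functionals hX hμ hnorm T

end Cantor

/-! ### Almost disjoint families -/

/-- An uncountable almost disjoint family of infinite sets of natural numbers. -/
theorem exists_almost_disjoint_family :
    ∃ L : (ℕ → Bool) → Set ℕ, (∀ σ, (L σ).Infinite) ∧ ∀ σ τ, σ ≠ τ → (L σ ∩ L τ).Finite := by
  -- The branches of the binary tree, coded as sets of integers: two distinct ones share finitely
  -- many nodes.
  let b : (ℕ → Bool) → ℕ → ℕ := fun σ n => Encodable.encode (PiNat.res σ n)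
  have hb : ∀ σ τ m n, b σ m = b τ n → m = n ∧ ∀ i < m, σ i = τ i := by
    intro σ τ m n h
    have h1 : PiNat.res σ m = PiNat.res τ n := Encodable.encode_injective h
    have h2 : m = n := by
      simpa [PiNat.res_length] using congrArg List.length h1
    subst h2
    exact ⟨rfl, fun i hi => PiNat.res_eq_res.1 h1 hi⟩
  refine ⟨fun σ => range (b σ), fun σ => infinite_range_of_injective fun m n h => (hb σ σ m n h).1,
    fun σ τ hστ => ?_⟩
  obtain ⟨i, hi⟩ := Function.ne_iff.1 hστ
  refine ((Set.finite_le_nat i).image (b σ)).subset ?_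
  rintro _ ⟨⟨m, rfl⟩, ⟨n, hn⟩⟩
  refine ⟨m, ?_, rfl⟩
  by_contra hm
  rw [mem_ofPred_eq, not_le] at hm
  exact hi ((hb σ τ m n hn.symm).2 i hm)

/-- A functional which vanishes on finitely supported sequences and is bounded in the supremum norm
is nonzero on the indicators of only countably many members of an almost disjoint family. -/
theorem countable_setOf_indicator_ne_zero {ι : Type*} {L : ι → Set ℕ}
    (hL : ∀ i j, i ≠ j → (L i ∩ L j).Finite) (φ : (ℕ → ℝ) → ℝ) {C : ℝ}
    (hadd : ∀ (t : Finset ι) (c : ι → ℝ), φ (∑ i ∈ t, c i • (L i).indicator 1) =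
      ∑ i ∈ t, c i * φ ((L i).indicator 1))
    (hbdd : ∀ a : ℕ → ℝ, (∀ᶠ n in atTop, |a n| ≤ 1) → |φ a| ≤ C) :
    {i | φ ((L i).indicator 1) ≠ 0}.Countable := by
  classical
  -- A signed sum of `N` such indicators is bounded by 1 off the finite pairwise intersections, yet
  -- `φ` is at least N/(k + 1) on it.
  have hfin : ∀ k : ℕ, {i | 1 / ((k : ℝ) + 1) ≤ |φ ((L i).indicator 1)|}.Finite := by
    intro k
    by_contra hinf
    obtain ⟨N, hN⟩ := exists_nat_gt (C * ((k : ℝ) + 1))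
    obtain ⟨t, ht, htc⟩ := Set.Infinite.exists_subset_card_eq hinf N
    let c : ι → ℝ := fun i => (SignType.sign (φ ((L i).indicator 1)) : ℝ)
    have hc : ∀ i, |c i| ≤ 1 := fun i => by
      rcases lt_trichotomy (φ ((L i).indicator 1)) 0 with h | h | h <;> simp [c, h]
    have h1 : |φ (∑ i ∈ t, c i • (L i).indicator 1)| ≤ C := by
      refine hbdd _ ?_
      have h2 : (⋃ p ∈ t.offDiag, L p.1 ∩ L p.2).Finite :=
        Set.Finite.biUnion t.offDiag.finite_toSet fun p hp =>
          hL _ _ (Finset.mem_offDiag.1 (Finset.mem_coe.1 hp)).2.2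
      have h3 : ∀ᶠ n in atTop, n ∉ ⋃ p ∈ t.offDiag, L p.1 ∩ L p.2 := by
        rw [← Nat.cofinite_eq_atTop]
        exact h2.compl_mem_cofinite
      filter_upwards [h3] with n hn
      simp only [Finset.sum_apply, Pi.smul_apply, smul_eq_mul, Set.indicator_apply, Pi.one_apply,
        mul_ite, mul_one, mul_zero]
      by_cases hex : ∃ i ∈ t, n ∈ L i
      · obtain ⟨i, hi, hni⟩ := hex
        rw [Finset.sum_eq_single_of_mem i hi, if_pos hni]
        · exact hc i
        · intro j hj hji
          refine if_neg fun hnj => hn (mem_iUnion₂.2 ⟨(j, i), ?_, hnj, hni⟩)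
          exact Finset.mem_offDiag.2 ⟨hj, hi, hji⟩
      · push Not at hex
        rw [Finset.sum_eq_zero fun i hi => if_neg (hex i hi)]
        simp
    have h2 : (N : ℝ) * (1 / ((k : ℝ) + 1)) ≤ φ (∑ i ∈ t, c i • (L i).indicator 1) := by
      rw [hadd, ← htc, ← nsmul_eq_mul]
      refine Finset.card_nsmul_le_sum _ _ _ fun i hi => ?_
      simp only [c]
      rw [sign_mul_self]
      exact ht hi
    have h3 := h2.trans ((le_abs_self _).trans h1)
    rw [mul_one_div, div_le_iff₀ (by positivity)] at h3
    linarith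
  refine (countable_iUnion fun k => (hfin k).countable).mono fun i hi => ?_
  obtain ⟨k, hk⟩ := exists_nat_one_div_lt (abs_pos.2 hi)
  exact mem_iUnion.2 ⟨k, hk.le⟩

/-! ### The Stone–Čech compactification of ω -/

section StoneCechNat

/-- The extension of a bounded sequence to the Stone–Čech compactification. -/
theorem exists_extension_stoneCech {a : ℕ → ℝ} {C : ℝ} (ha : ∀ n, |a n| ≤ C) :
    ∃ f : C(StoneCech ℕ, ℝ), (∀ n, f (stoneCechUnit n) = a n) := by
  let g : ℕ → Icc (-C) C := fun n => ⟨a n, abs_le.1 (ha n)⟩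
  have hg : Continuous g := continuous_of_discreteTopology
  refine ⟨⟨fun x => ((stoneCechExtend hg x : Icc (-C) C) : ℝ),
    continuous_subtype_val.comp (continuous_stoneCechExtend hg)⟩, fun n => ?_⟩
  simp [stoneCechExtend_stoneCechUnit, g]

theorem stoneCech_nat_ext {f g : C(StoneCech ℕ, ℝ)}
    (h : ∀ n, f (stoneCechUnit n) = g (stoneCechUnit n)) : f = g :=
  ContinuousMap.ext fun x => congrFun (stoneCech_hom_ext f.continuous g.continuous (funext h)) x

theorem abs_le_of_stoneCech_nat {f : C(StoneCech ℕ, ℝ)} {C : ℝ}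
    (h : ∀ n, |f (stoneCechUnit n)| ≤ C) (x : StoneCech ℕ) : |f x| ≤ C := by
  have hc : IsClosed {x | |f x| ≤ C} := isClosed_le (by fun_prop) continuous_const
  exact denseRange_stoneCechUnit.induction_on x hc h

theorem isOpen_singleton_stoneCechUnit (n : ℕ) : IsOpen {(stoneCechUnit n : StoneCech ℕ)} := by
  classical
  obtain ⟨f, hf⟩ := exists_extension_stoneCech (a := fun m => if m = n then (1 : ℝ) else 0) (C := 1)
    (fun m => by split_ifs <;> simp)
  have hopen : IsOpen {x | 1 / 2 < f x} := isOpen_lt continuous_const f.continuous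
  convert hopen using 1
  ext x
  constructor
  · rintro rfl
    norm_num [hf]
  · intro hx
    by_contra hne
    have hopen' : IsOpen ({x | 1 / 2 < f x} \ {stoneCechUnit n}) := hopen.sdiff isClosed_singleton
    obtain ⟨m, hm⟩ := denseRange_stoneCechUnit.exists_mem_open hopen' ⟨x, hx, hne⟩
    have h1 : m ≠ n := fun h => hm.2 (by rw [h]; rfl)
    have h2 : 1 / 2 < f (stoneCechUnit m) := hm.1
    rw [hf, if_neg h1] at h2
    norm_num at h2

/-- The remainder has no isolated point. Near such a point there would be infinitely many integers,
every infinite set of which accumulates at that point; two disjoint infinite halves are separated by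
the extension of an indicator. -/
theorem not_isScatteredSpace_stoneCech_nat : ¬ IsScatteredSpace (StoneCech ℕ) := by
  classical
  intro hs
  have hinj : Function.Injective (stoneCechUnit : ℕ → StoneCech ℕ) := by
    intro m n h
    obtain ⟨f, hf⟩ := exists_extension_stoneCech (a := fun k => if k = n then (1 : ℝ) else 0)
      (C := 1) (fun m => by split_ifs <;> simp)
    by_contra hmn
    have h1 := hf m
    rw [h, hf n] at h1
    simp [hmn] at h1
  have hacc : ∀ N : Set ℕ, N.Infinite → ∃ x, x ∉ range (stoneCechUnit : ℕ → StoneCech ℕ) ∧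
      x ∈ closure (stoneCechUnit '' N) := by
    intro N hN
    obtain ⟨x, hx⟩ := (hN.image hinj.injOn).exists_accPt_principal
    refine ⟨x, ?_, mem_closure_iff_clusterPt.2 hx.clusterPt⟩
    rintro ⟨n, rfl⟩
    obtain ⟨y, hy, hne⟩ := accPt_iff_nhds.1 hx _ ((isOpen_singleton_stoneCechUnit n).mem_nhds rfl)
    exact hne hy.1
  obtain ⟨x, hx, U, hU, hUx⟩ := hs (range stoneCechUnit)ᶜ (by
    obtain ⟨x, hx, -⟩ := hacc univ infinite_univ
    exact ⟨x, hx⟩)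
  have hxU : x ∈ U := (hUx.symm.subset rfl).1
  obtain ⟨V, hV, hVcl, hVU⟩ := exists_mem_nhds_isClosed_subset (hU.mem_nhds hxU)
  let N : Set ℕ := {n | (stoneCechUnit n : StoneCech ℕ) ∈ V}
  have hNinf : N.Infinite := by
    intro hfin
    have hcl : IsClosed ((stoneCechUnit : ℕ → StoneCech ℕ) '' N) := (hfin.image _).isClosed
    have hopen : IsOpen (interior V \ stoneCechUnit '' N) := isOpen_interior.sdiff hcl
    obtain ⟨n, hn⟩ := denseRange_stoneCechUnit.exists_mem_open hopen
      ⟨x, mem_interior_iff_mem_nhds.2 hV, fun ⟨n, _, hn⟩ => hx ⟨n, hn⟩⟩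
    have hnV : (stoneCechUnit n : StoneCech ℕ) ∈ V := interior_subset hn.1
    exact hn.2 ⟨n, hnV, rfl⟩
  have huniq : ∀ M ⊆ N, M.Infinite → x ∈ closure (stoneCechUnit '' M) := by
    intro M hM hMinf
    obtain ⟨y, hy, hycl⟩ := hacc M hMinf
    have hyV : y ∈ V := closure_minimal (by rintro _ ⟨n, hn, rfl⟩; exact hM hn) hVcl hycl
    have : y ∈ U ∩ (range stoneCechUnit)ᶜ := ⟨hVU hyV, hy⟩
    rw [hUx] at this
    exact this ▸ hycl
  let e : ℕ ↪ N := hNinf.natEmbedding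
  let e' : ℕ → ℕ := fun k => (e k : ℕ)
  have he' : Function.Injective e' := Subtype.val_injective.comp e.injective
  let M₁ : Set ℕ := range fun k => e' (2 * k)
  let M₂ : Set ℕ := range fun k => e' (2 * k + 1)
  have h1 : x ∈ closure (stoneCechUnit '' M₁) := huniq M₁
    (by rintro _ ⟨k, rfl⟩; exact (e (2 * k)).2)
    (infinite_range_of_injective fun i j h => by have := he' h; omega)
  have h2 : x ∈ closure (stoneCechUnit '' M₂) := huniq M₂
    (by rintro _ ⟨k, rfl⟩; exact (e (2 * k + 1)).2)
    (infinite_range_of_injective fun i j h => by have := he' h; omega)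
  obtain ⟨f, hf⟩ := exists_extension_stoneCech (a := M₁.indicator 1) (C := 1) (fun m => by
    by_cases h : m ∈ M₁ <;> simp [h])
  have h3 : f x = 1 := closure_minimal (t := {y | f y = 1})
    (by rintro _ ⟨n, hn, rfl⟩; simp [hf, hn]) (isClosed_eq f.continuous continuous_const) h1
  have h4 : f x = 0 := closure_minimal (t := {y | f y = 0})
    (by
      rintro _ ⟨n, ⟨k, rfl⟩, rfl⟩
      have : e' (2 * k + 1) ∉ M₁ := by
        rintro ⟨j, hj⟩
        have := he' hj
        omega
      simp [hf, this]) (isClosed_eq f.continuous continuous_const) h2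
  rw [h3] at h4
  norm_num at h4

theorem ZeroAtInftyContinuousMap.coe_mem_c0p (u : ZeroAtInftyContinuousMap ℕ ℝ) : ⇑u ∈ c0p := by
  have h := u.zero_at_infty'
  rw [cocompact_eq_cofinite, Nat.cofinite_eq_atTop] at h
  exact h

/-- The space `c₀` of null sequences with its norm, mapped to `(c₀)ₚ`. -/
noncomputable def c0ToC0p : ZeroAtInftyContinuousMap ℕ ℝ →L[ℝ] c0p where
  toFun u := ⟨u, u.coe_mem_c0p⟩
  map_add' _ _ := rfl
  map_smul' _ _ := rfl
  cont := Continuous.subtype_mk (continuous_pi fun n => by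
    have h : Continuous fun u : ZeroAtInftyContinuousMap ℕ ℝ => u.toBCF n :=
      (continuous_eval_const n).comp
        ZeroAtInftyContinuousMap.isometry_toBCF.continuous
    exact h) fun u => u.coe_mem_c0p

theorem finitelySupported_mem_c0p {a : ℕ → ℝ} {N : ℕ} (ha : ∀ j, N ≤ j → a j = 0) : a ∈ c0p :=
  tendsto_const_nhds.congr' (by
    filter_upwards [eventually_ge_atTop N] with j hj using (ha j hj).symm)

/-- The basis vectors of `(c₀)ₚ`. -/
noncomputable def c0pBasis (j : ℕ) : c0p :=
  ⟨Pi.single j 1, finitelySupported_mem_c0p (N := j + 1) fun i hi => by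
    rw [Pi.single_eq_of_ne (by omega)]⟩

theorem eq_sum_c0pBasis {a : ℕ → ℝ} {N : ℕ} (ha : ∀ j, N ≤ j → a j = 0) :
    (⟨a, finitelySupported_mem_c0p ha⟩ : c0p) = ∑ j ∈ Finset.range N, a j • c0pBasis j := by
  ext i
  simp only [c0pBasis, Submodule.coe_sum, Submodule.coe_smul, Finset.sum_apply, Pi.smul_apply,
    smul_eq_mul, Pi.single_apply, mul_ite, mul_one, mul_zero, Finset.sum_ite_eq, Finset.mem_range]
  split_ifs with h
  · rfl
  · exact ha i (by omega)

/-- A continuous operator from `(c₀)ₚ` to `C_p(X)` maps the basis to a weakly unconditionally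
Cauchy series. -/
theorem exists_bound_sum_abs {X : Type*} [TopologicalSpace X] [CompactSpace X]
    (S : c0p →L[ℝ] Cp X ℝ) :
    ∃ C, ∀ x (t : Finset ℕ), ∑ j ∈ t, |(S (c0pBasis j)).1 x| ≤ C := by
  -- On the Banach space c₀ these functionals are pointwise bounded, since each image is continuous
  -- on a compact space. Uniform boundedness, tested on finite sign vectors, gives the estimate.
  let ψ : X → ZeroAtInftyContinuousMap ℕ ℝ →L[ℝ] ℝ := fun x =>
    { toFun := fun u => (S (c0ToC0p u)).1 x
      map_add' := fun u v => by simp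
      map_smul' := fun c u => by simp
      cont := (continuous_apply x).comp (continuous_subtype_val.comp
        (S.continuous.comp c0ToC0p.continuous)) }
  obtain ⟨C, hC⟩ := banach_steinhaus (g := ψ) (by
    intro u
    obtain ⟨C, hC⟩ := (isCompact_range (S (c0ToC0p u)).2).isBounded.exists_norm_le
    exact ⟨C, fun x => hC _ ⟨x, rfl⟩⟩)
  refine ⟨C, fun x t => ?_⟩
  obtain ⟨N, hN⟩ : ∃ N, t ⊆ Finset.range N :=
    ⟨t.sup id + 1, fun j hj => Finset.mem_range.2 (Nat.lt_succ_of_le (Finset.le_sup (f := id) hj))⟩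
  refine (Finset.sum_le_sum_of_subset_of_nonneg hN fun _ _ _ => abs_nonneg _).trans ?_
  let a : ℕ → ℝ := fun j => if j < N then (SignType.sign ((S (c0pBasis j)).1 x) : ℝ) else 0
  have ha : ∀ j, N ≤ j → a j = 0 := fun j hj => if_neg (by omega)
  have ha1 : ∀ j, |a j| ≤ 1 := fun j => by
    simp only [a]
    split_ifs
    · rcases lt_trichotomy ((S (c0pBasis j)).1 x) 0 with h | h | h <;> simp [h]
    · simp
  let u : ZeroAtInftyContinuousMap ℕ ℝ :=
    { toFun := a
      continuous_toFun := continuous_of_discreteTopology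
      zero_at_infty' := by
        rw [cocompact_eq_cofinite, Nat.cofinite_eq_atTop]
        exact finitelySupported_mem_c0p ha }
  have hu : ‖u‖ ≤ 1 := by
    rw [← ZeroAtInftyContinuousMap.norm_toBCF_eq_norm]
    exact (BoundedContinuousFunction.norm_le zero_le_one).2 ha1
  have h0 : ψ x u = (S ⟨a, finitelySupported_mem_c0p ha⟩).1 x := rfl
  have h1 : ψ x u = ∑ j ∈ Finset.range N, |(S (c0pBasis j)).1 x| := by
    rw [h0]
    rw [eq_sum_c0pBasis ha]
    simp only [map_sum, map_smul, Submodule.coe_sum, Submodule.coe_smul, Finset.sum_apply,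
      Pi.smul_apply, smul_eq_mul]
    refine Finset.sum_congr rfl fun j hj => ?_
    simp only [a, Finset.mem_range.1 hj, if_true]
    exact sign_mul_self _
  rw [← h1]
  calc ψ x u ≤ ‖ψ x u‖ := le_abs_self _
    _ ≤ ‖ψ x‖ * ‖u‖ := (ψ x).le_opNorm u
    _ ≤ ‖ψ x‖ * 1 := mul_le_mul_of_nonneg_left hu (norm_nonneg (ψ x))
    _ ≤ C := by rw [mul_one]; exact hC x

/-- The embedding `S` extends to an operator `St` on bounded sequences. The functionals a ↦ a_k -
(P(St a))_k kill finitely supported sequences, so for some infinite set of an almost disjoint family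
all of them kill its indicator, which would then lie in the range of `P`. -/
theorem not_containsComplementedCopy_stoneCech_nat :
    ¬ ContainsComplementedCopy (Cp (StoneCech ℕ) ℝ) c0p := by
  classical
  rintro ⟨E₁, E₂, -, -, hcompl, ⟨Φ⟩⟩
  let P : Cp (StoneCech ℕ) ℝ →L[ℝ] c0p :=
    (Φ : E₁ →L[ℝ] c0p).comp (E₁.projectionOntoL E₂ hcompl)
  let S : c0p →L[ℝ] Cp (StoneCech ℕ) ℝ := E₁.subtypeL.comp (Φ.symm : c0p →L[ℝ] E₁)
  have hPS : ∀ a, P (S a) = a := fun a => by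
    simp [P, S, Submodule.projectionOntoL_apply_left]
  obtain ⟨C, hC⟩ := exists_bound_sum_abs S
  let e : ℕ → StoneCech ℕ → ℝ := fun j x => (S (c0pBasis j)).1 x
  have hsummable : ∀ x, Summable fun j => |e j x| := fun x =>
    summable_of_sum_le (fun _ => abs_nonneg _) (hC x)
  have hmul : ∀ (a : ℕ → ℝ) (D : ℝ), (∀ j, |a j| ≤ D) → ∀ x,
      Summable (fun j => a j * e j x) ∧ |∑' j, a j * e j x| ≤ D * C := by
    intro a D ha x
    have hle : ∀ j, ‖a j * e j x‖ ≤ D * |e j x| := fun j => by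
      rw [norm_mul]
      exact mul_le_mul_of_nonneg_right (ha j) (norm_nonneg _)
    have hs : Summable fun j => D * |e j x| := (hsummable x).mul_left D
    refine ⟨Summable.of_norm_bounded hs hle, ?_⟩
    refine (tsum_of_norm_bounded hs.hasSum hle).trans ?_
    rw [tsum_mul_left]
    exact mul_le_mul_of_nonneg_left ((hsummable x).tsum_le_of_sum_le (hC x))
      ((abs_nonneg _).trans (ha 0))
  -- The series is prescribed only on ω and extended by continuity; unbounded sequences get the
  -- default 0, so linearity is available only for bounded ones.
  have hext : ∀ a : ℕ → ℝ, ∃ f : C(StoneCech ℕ, ℝ), (∃ D, ∀ j, |a j| ≤ D) →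
      ∀ n, f (stoneCechUnit n) = ∑' j, a j * e j (stoneCechUnit n) := by
    intro a
    by_cases ha : ∃ D, ∀ j, |a j| ≤ D
    · obtain ⟨D, hD⟩ := ha
      obtain ⟨f, hf⟩ := exists_extension_stoneCech (fun n => (hmul a D hD (stoneCechUnit n)).2)
      exact ⟨f, fun _ => hf⟩
    · exact ⟨0, fun h => absurd h ha⟩
  choose St hSt using hext
  let incl : C(StoneCech ℕ, ℝ) →L[ℝ] Cp (StoneCech ℕ) ℝ :=
    { toFun := fun f => ⟨f, f.continuous⟩
      map_add' := fun _ _ => rfl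
      map_smul' := fun _ _ => rfl
      cont := Continuous.subtype_mk (continuous_pi fun x => continuous_eval_const x) _ }
  let p : ℕ → C(StoneCech ℕ, ℝ) →L[ℝ] ℝ := fun k =>
    (ContinuousLinearMap.proj k).comp (c0p.subtypeL.comp (P.comp incl))
  let φ : ℕ → (ℕ → ℝ) → ℝ := fun k a => a k - p k (St a)
  have hφsum : ∀ k {ι : Type} (t : Finset ι) (c : ι → ℝ) (u : ι → ℕ → ℝ),
      (∀ i, ∃ D, ∀ j, |u i j| ≤ D) → φ k (∑ i ∈ t, c i • u i) = ∑ i ∈ t, c i * φ k (u i) := by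
    intro k ι t c u hu
    have h1 : St (∑ i ∈ t, c i • u i) = ∑ i ∈ t, c i • St (u i) := by
      refine stoneCech_nat_ext fun n => ?_
      choose D hD using hu
      rw [hSt _ ⟨∑ i ∈ t, |c i| * D i, fun j => ?_⟩]
      · have h2 : HasSum (fun j => ∑ i ∈ t, c i * (u i j * e j (stoneCechUnit n)))
            (∑ i ∈ t, c i * St (u i) (stoneCechUnit n)) := by
          refine hasSum_sum fun i _ => HasSum.mul_left _ ?_
          rw [hSt (u i) ⟨D i, hD i⟩ n]
          exact (hmul (u i) (D i) (hD i) _).1.hasSum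
        have h3 : ∀ j, (∑ i ∈ t, c i • u i) j * e j (stoneCechUnit n) =
            ∑ i ∈ t, c i * (u i j * e j (stoneCechUnit n)) := fun j => by
          simp only [Finset.sum_apply, Pi.smul_apply, smul_eq_mul, Finset.sum_mul, mul_assoc]
        simp_rw [h3]
        rw [h2.tsum_eq]
        simp
      · simp only [Finset.sum_apply, Pi.smul_apply, smul_eq_mul]
        refine (Finset.abs_sum_le_sum_abs _ _).trans (Finset.sum_le_sum fun i _ => ?_)
        rw [abs_mul]
        exact mul_le_mul_of_nonneg_left (hD i j) (abs_nonneg _)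
    simp only [φ, h1, map_sum, map_smul, smul_eq_mul, Finset.sum_apply, Pi.smul_apply, mul_sub,
      Finset.sum_sub_distrib]
  have hφfin : ∀ k (a : ℕ → ℝ) (N : ℕ), (∀ j, N ≤ j → a j = 0) → φ k a = 0 := by
    intro k a N ha
    have hbd : ∃ D, ∀ j, |a j| ≤ D := by
      obtain ⟨D, hD⟩ := (Metric.isBounded_range_of_tendsto a
        (finitelySupported_mem_c0p ha)).exists_norm_le
      exact ⟨D, fun j => hD _ ⟨j, rfl⟩⟩
    have h1 : incl (St a) = S ⟨a, finitelySupported_mem_c0p ha⟩ := by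
      refine Subtype.ext (congrArg DFunLike.coe (stoneCech_nat_ext (f := St a)
        (g := ⟨(S ⟨a, finitelySupported_mem_c0p ha⟩).1, (S _).2⟩) fun n => ?_))
      rw [hSt a hbd, tsum_eq_sum (s := Finset.range N) fun j hj => by
        rw [ha j (by simpa using hj), zero_mul]]
      change _ = (S ⟨a, finitelySupported_mem_c0p ha⟩).1 (stoneCechUnit n)
      rw [eq_sum_c0pBasis ha]
      simp only [map_sum, map_smul, Submodule.coe_sum, Submodule.coe_smul, Finset.sum_apply,
        Pi.smul_apply, smul_eq_mul, e]
    have h2 : p k (St a) = (P (incl (St a))).1 k := rfl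
    simp only [φ]
    rw [h2, h1, hPS, sub_self]
  have hφbdd : ∀ k (a : ℕ → ℝ), (∀ᶠ n in atTop, |a n| ≤ 1) → |φ k a| ≤ 1 + ‖p k‖ * |C| := by
    intro k a ha
    obtain ⟨N, hN⟩ := eventually_atTop.1 ha
    -- The finite head of `a` does not affect `φ k`, so the bound needs `|a j| ≤ 1` only on the
    -- tail.
    let u : Bool → ℕ → ℝ := fun b j => if b then (if j < N then 0 else a j) else
      (if j < N then a j else 0)
    have hu1 : ∀ j, |u true j| ≤ 1 := fun j => by
      simp only [u, if_true]
      split_ifs with h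
      · simp
      · exact hN j (by omega)
    have hu0 : ∀ j, N ≤ j → u false j = 0 := fun j hj => by
      simp [u, not_lt.2 hj]
    have hbd : ∀ b, ∃ D, ∀ j, |u b j| ≤ D := by
      rintro (_ | _)
      · obtain ⟨D, hD⟩ := (Metric.isBounded_range_of_tendsto _
          (finitelySupported_mem_c0p hu0)).exists_norm_le
        exact ⟨D, fun j => hD _ ⟨j, rfl⟩⟩
      · exact ⟨1, hu1⟩
    have hsplit : a = ∑ b ∈ Finset.univ, (1 : ℝ) • u b := by
      ext j
      by_cases h : j < N <;> simp [u, h]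
    have h1 : φ k a = φ k (u true) := by
      conv_lhs => rw [hsplit]
      rw [hφsum k Finset.univ (fun _ => 1) u hbd]
      simp [hφfin k (u false) N hu0]
    rw [h1]
    have h2 : ‖St (u true)‖ ≤ |C| := by
      refine (ContinuousMap.norm_le _ (abs_nonneg _)).2 (abs_le_of_stoneCech_nat fun n => ?_)
      rw [hSt _ ⟨1, hu1⟩]
      have := (hmul (u true) 1 hu1 (stoneCechUnit n)).2
      rw [one_mul] at this
      exact this.trans (le_abs_self _)
    refine (abs_sub _ _).trans (add_le_add (hu1 k) ?_)
    exact ((p k).le_opNorm _).trans (mul_le_mul_of_nonneg_left h2 (norm_nonneg _))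
  obtain ⟨L, hLinf, hLad⟩ := exists_almost_disjoint_family
  have hcount : (⋃ k, {σ | φ k ((L σ).indicator 1) ≠ 0}).Countable := countable_iUnion fun k =>
    countable_setOf_indicator_ne_zero hLad (φ k)
      (fun t c => hφsum k t c _ fun σ => ⟨1, fun j => by
        by_cases h : j ∈ L σ <;> simp [h]⟩) (hφbdd k)
  obtain ⟨σ, hσ⟩ : ∃ σ, σ ∉ ⋃ k, {σ | φ k ((L σ).indicator 1) ≠ 0} := by
    by_contra hall
    push Not at hall
    rw [eq_univ_of_forall hall] at hcount
    have : Countable (ℕ → Bool) := countable_univ_iff.1 hcount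
    obtain ⟨g, hg⟩ := exists_surjective_nat (ℕ → Bool)
    obtain ⟨n, hn⟩ := hg fun n => !g n n
    have := congrFun hn n
    simp at this
  have hfix : ∀ k, (L σ).indicator (1 : ℕ → ℝ) k = (P (incl (St ((L σ).indicator 1)))).1 k := by
    intro k
    have h1 : φ k ((L σ).indicator 1) = 0 := by
      by_contra h
      exact hσ (mem_iUnion.2 ⟨k, h⟩)
    exact sub_eq_zero.1 h1
  have hlim : Tendsto ((L σ).indicator (1 : ℕ → ℝ)) atTop (𝓝 0) := by
    rw [funext hfix]
    exact (P (incl (St ((L σ).indicator 1)))).2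
  have hev := hlim.eventually (gt_mem_nhds (show (0 : ℝ) < 1 by norm_num))
  obtain ⟨N, hN⟩ := eventually_atTop.1 hev
  obtain ⟨n, hn, hNn⟩ := (hLinf σ).exists_gt N
  have := hN n hNn.le
  simp [hn] at this

end StoneCechNat

/-! ### The theorem -/

theorem mainTheorem11 :
    (∀ (X : Type*) [TopologicalSpace X] [CompactSpace X] [T2Space X],
      ¬ IsScatteredSpace X →
      ¬ ContainsComplementedCopy (Cp X ℝ) c0p →
      ¬ ∃ T : Cp X (Cp X ℝ) →L[ℝ] Cp X (WeakSpace ℝ C(X, ℝ)), Function.Surjective T) ∧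
    (¬ IsScatteredSpace (StoneCech ℕ) ∧
      ¬ ContainsComplementedCopy (Cp (StoneCech ℕ) ℝ) c0p ∧
      ¬ ∃ T : Cp (StoneCech ℕ) (Cp (StoneCech ℕ) ℝ) →L[ℝ]
          Cp (StoneCech ℕ) (WeakSpace ℝ C(StoneCech ℕ, ℝ)), Function.Surjective T) := by
  refine ⟨fun X _ _ _ hs hX => ?_, not_isScatteredSpace_stoneCech_nat,
    not_containsComplementedCopy_stoneCech_nat, ?_⟩
  · rintro ⟨T, hT⟩
    exact not_surjective_of_not_isScatteredSpace hs hX T hT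
  · rintro ⟨T, hT⟩
    exact not_surjective_of_not_isScatteredSpace not_isScatteredSpace_stoneCech_nat
      not_containsComplementedCopy_stoneCech_nat T hT
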